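/- For the set $\Phi=\{\mathbf e_1,\mathbf e_2\}$ of standard basis vectors of $\mathbb R^2$ (the square lattice) let $$\phi(x)=\frac{1}{2|\Phi|}\sum_{\mathbf s\in\pm\Phi}e^{i\langle \mathbf s,x\rangle},\qquad F_n=\sum_{\substack{0\le j,k\le n-1\\(j,k)\ne(0,0)}}\frac{1}{1-\phi(x_{j,k})},\qquad x_{j,k}=\frac{2\pi j}{n}\beta_1+\frac{2\pi k}{n}\beta_2,$$ where $\beta_1,\beta_2$ is the basis dual to $\mathbf e_1,\mathbf e_2$ and $n\ge 1$ is an integer. Then $$F_n=\sum_{\substack{0\le j,k\le n-1\\(j,k)\ne(0,0)}}\frac{1}{1-\frac12\left(\cos\frac{2\pi j}{n}+\cos\frac{2\pi k}{n}\right)}\qquad(n\ge1),$$ and, as $n\to\infty$, $$F_n=\frac{2}{\pi}\,n^2\log n+\frac1\pi\left(2\gamma+\log\frac{32\pi}{\Gamma(1/4)^4}\right)n^2+\mathcal O(\log n),$$ where $\gamma$ is Euler's constant and $\Gamma$ is the Gamma function. -/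

import Mathlib

open Asymptotics Filter

noncomputable section

/-- `φ(x) = (1 / (2|Φ|)) ∑_{s ∈ ±Φ} exp (i ⟨s, x⟩)` for a finite collection `Φ` of vectors of `V`
and `x` in the dual of `V`; each `s ∈ Φ` contributes the two terms `s` and `-s`. -/
def phi {V : Type*} [AddCommGroup V] [Module ℝ V] (Φ : Finset V) (x : Module.Dual ℝ V) : ℂ :=
  1 / (2 * (Φ.card : ℂ)) *
    ∑ s ∈ Φ, (Complex.exp (Complex.I * ((x s : ℝ) : ℂ)) +
      Complex.exp (Complex.I * ((x (-s) : ℝ) : ℂ)))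

/-- The point `x_{j,k} = (2πj/n) β₁ + (2πk/n) β₂`, where `β₁, β₂` is the basis dual to `b`. -/
def dualPoint {V : Type*} [AddCommGroup V] [Module ℝ V] (b : Module.Basis (Fin 2) ℝ V)
    (n j k : ℕ) : Module.Dual ℝ V :=
  (2 * Real.pi * j / n) • b.coord 0 + (2 * Real.pi * k / n) • b.coord 1

/-- `F_n(Φ) = ∑ 1 / (1 - φ(x_{j,k}))` over `0 ≤ j, k ≤ n - 1` with `(j,k) ≠ (0,0)`, computed in a
basis `b` of the lattice generated by `Φ`. -/
def latticeSum {V : Type*} [AddCommGroup V] [Module ℝ V] (Φ : Finset V)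
    (b : Module.Basis (Fin 2) ℝ V) (n : ℕ) : ℂ :=
  ∑ p ∈ (Finset.range n ×ˢ Finset.range n).erase (0, 0),
    1 / (1 - phi Φ (dualPoint b n p.1 p.2))

/-- `Φ = {e₁, e₂} ⊆ ℝ²`, the positive roots of type `A₁ × A₁`. -/
def squarePhi : Finset (Fin 2 → ℝ) := {Pi.single 0 1, Pi.single 1 1}

/-- The explicit form of `F_n` for the square lattice. -/
def squareSum (n : ℕ) : ℝ :=
  ∑ p ∈ (Finset.range n ×ˢ Finset.range n).erase (0, 0),
    1 / (1 - 1 / 2 * (Real.cos (2 * Real.pi * p.1 / n) + Real.cos (2 * Real.pi * p.2 / n)))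

end

/-! The inner sum over k is a discrete Poisson kernel sum and has a closed form. The row j = 0 gives
(n² - 1)/3. With θ = πj/n and x = exp(2 arsinh(sin θ)), any other row gives n · `kern θ` · (1 +
2/(xⁿ - 1)), where `kern θ` = 1/(sin θ √(1 + sin² θ)) (`squareSum_eq`). Two single sums remain.

The sum of `kern` has simple poles at both ends of (0, π). Subtracting 1/θ + 1/(π - θ) leaves a C²
function, to which the trapezoidal rule applies; the poles contribute harmonic numbers, hence log n
and γ (`exists_abs_sum_kern_sub`). In the second sum only j near 0 or near n matters. There
arsinh(sin θ) is close to the distance to the endpoint, and the sum tends, up to the factor 2n/π, to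
the Lambert series ∑ 1/(j(e^{2πj} - 1)) (`exists_abs_sum_kern_div_sub`).

That series equals -log ∏(1 - e^{-2πm}), so it is determined by η(i) = Γ(1/4)/(2π^{3/4}). To find
η(i), note that E₆(i) = 0, so 1728 η(i)²⁴ = E₄(i)³, and E₄(i) is a multiple of the invariant g₂ of
ℤ[i]. On the real axis ℘ satisfies ℘'² = 4℘³ - g₂℘; integrating over half a period expresses g₂
through B(1/4, 1/2) (`invariant_eq`). The π/12 from η(i) cancels the n²/3 of the row j = 0. The
error obtained is in fact O(1). -/

/-! ### Symmetries and Eisenstein sums of the Gaussian lattice. -/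

/-- The Gaussian integers `ℤ + ℤ i` as a period lattice. -/
noncomputable def gaussPeriodPair : PeriodPair where
  ω₁ := 1
  ω₂ := Complex.I
  indep := by
    rw [LinearIndependent.pair_iff]
    intro s t h
    have h1 := congrArg Complex.re h
    have h2 := congrArg Complex.im h
    simp at h1 h2
    exact ⟨h1, h2⟩

namespace GaussLattice

open Complex

lemma mem_iff {z : ℂ} :
    z ∈ gaussPeriodPair.lattice ↔ ∃ m n : ℤ, z = (m : ℂ) + n * I := by
  rw [PeriodPair.mem_lattice]
  simp only [gaussPeriodPair]
  constructor
  · rintro ⟨m, n, h⟩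
    exact ⟨m, n, by rw [← h]; simp⟩
  · rintro ⟨m, n, h⟩
    exact ⟨m, n, by rw [h]; simp⟩

lemma conj_mem {z : ℂ} (hz : z ∈ gaussPeriodPair.lattice) :
    (starRingEnd ℂ) z ∈ gaussPeriodPair.lattice := by
  obtain ⟨m, n, rfl⟩ := mem_iff.mp hz
  exact mem_iff.mpr ⟨m, -n, by simp⟩

lemma I_mul_mem {z : ℂ} (hz : z ∈ gaussPeriodPair.lattice) :
    I * z ∈ gaussPeriodPair.lattice := by
  obtain ⟨m, n, rfl⟩ := mem_iff.mp hz
  refine mem_iff.mpr ⟨-n, m, ?_⟩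
  push_cast
  linear_combination (n : ℂ) * I_mul_I

lemma ofReal_notMem {x : ℝ} (h0 : 0 < x) (h1 : x < 1) :
    (x : ℂ) ∉ gaussPeriodPair.lattice := by
  intro h
  obtain ⟨m, n, h⟩ := mem_iff.mp h
  have h2 := congrArg Complex.re h
  simp at h2
  subst h2
  have : (0 : ℤ) < m := by exact_mod_cast h0
  have : m < (1 : ℤ) := by exact_mod_cast h1
  omega

/-- Complex conjugation as a permutation of the Gaussian lattice. -/
noncomputable def conjEquiv : gaussPeriodPair.lattice ≃ gaussPeriodPair.lattice where
  toFun l := ⟨(starRingEnd ℂ) l, conj_mem l.2⟩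
  invFun l := ⟨(starRingEnd ℂ) l, conj_mem l.2⟩
  left_inv l := by ext; simp
  right_inv l := by ext; simp

/-- Multiplication by `i` as a permutation of the Gaussian lattice. -/
noncomputable def mulIEquiv : gaussPeriodPair.lattice ≃ gaussPeriodPair.lattice where
  toFun l := ⟨I * l, I_mul_mem l.2⟩
  invFun l := ⟨-(I * l), neg_mem (I_mul_mem l.2)⟩
  left_inv l := by ext; simp [← mul_assoc]
  right_inv l := by ext; simp [← mul_assoc]

/-- Multiplication by i permutes the lattice and changes the sign of each term, since i⁶ = -1. -/
lemma G_six : gaussPeriodPair.G 6 = 0 := by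
  have h : gaussPeriodPair.G 6 = -gaussPeriodPair.G 6 := by
    conv_lhs => rw [PeriodPair.G, ← mulIEquiv.tsum_eq]
    rw [PeriodPair.G, ← tsum_neg]
    refine tsum_congr fun l => ?_
    have hI : I ^ 6 = -1 := by
      rw [show (6 : ℕ) = 2 * 3 from rfl, pow_mul, I_sq]; norm_num
    simp [mulIEquiv, mul_pow, hI, inv_neg]
  exact CharZero.eq_neg_self_iff.mp h

lemma conj_G (k : ℕ) : (starRingEnd ℂ) (gaussPeriodPair.G k) = gaussPeriodPair.G k := by
  rw [PeriodPair.G, Complex.conj_tsum, ← conjEquiv.tsum_eq]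
  simp [conjEquiv]

lemma conj_weierstrassP (x : ℝ) :
    (starRingEnd ℂ) (gaussPeriodPair.weierstrassP x) = gaussPeriodPair.weierstrassP x := by
  rw [PeriodPair.weierstrassP, Complex.conj_tsum, ← conjEquiv.tsum_eq]
  simp [conjEquiv]

-- Bridge from lattice sums to modular forms: collecting the gcd of each pair (m, n) produces ζ(k)
-- times a sum over coprime pairs, of which E is one half.
open UpperHalfPlane EisensteinSeries in
lemma G_eq {k : ℕ} (hk : 3 ≤ k) :
    gaussPeriodPair.G k = 2 * riemannZeta k * ModularForm.E hk UpperHalfPlane.I := by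
  have h2 := tsum_eisSummand_eq_riemannZeta_mul_eisensteinSeries hk UpperHalfPlane.I
  have h1 : ModularForm.E hk UpperHalfPlane.I
      = (1 / 2 : ℂ) * eisensteinSeries (N := 1) 0 k UpperHalfPlane.I := rfl
  rw [h1, show 2 * riemannZeta k * (1 / 2 * eisensteinSeries (N := 1) 0 k UpperHalfPlane.I)
    = riemannZeta k * eisensteinSeries (N := 1) 0 k UpperHalfPlane.I by ring, ← h2, PeriodPair.G,
    ← gaussPeriodPair.latticeEquivProd.symm.toEquiv.tsum_eq,
    ← ((finTwoArrowEquiv ℤ).trans (Equiv.prodComm ℤ ℤ)).tsum_eq]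
  refine tsum_congr fun v => ?_
  have hv : ((gaussPeriodPair.latticeEquivProd.symm (v 1, v 0) :
      gaussPeriodPair.lattice) : ℂ) = v 0 * Complex.I + v 1 := by
    refine (gaussPeriodPair.latticeEquiv_symm_apply (v 1, v 0)).trans ?_
    simp [gaussPeriodPair, add_comm]
  simp [eisSummand, hv]

end GaussLattice

/-! ### The equation p'² = 4p(p² - e²) on (0, 1) and its half-period integral. -/

namespace LemniscateODE

open Set Topology

variable {p p' : ℝ → ℝ} {e : ℝ}

/-- A square cannot be negative, so p omits (0, e). As p is large near 0, a value below e would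
force p to take the value e/2. -/
lemma le_of_ode (he : 0 < e) (hd : ∀ x ∈ Ioo (0 : ℝ) 1, HasDerivAt p (p' x) x)
    (hode : ∀ x ∈ Ioo (0 : ℝ) 1, p' x ^ 2 = 4 * p x * (p x ^ 2 - e ^ 2))
    (htop : Tendsto p (𝓝[>] 0) atTop) {x : ℝ} (hx : x ∈ Ioo (0 : ℝ) 1) : e ≤ p x := by
  by_contra! hlt
  have hxe : p x ≤ e / 2 := by
    by_contra! h
    have h1 := hode x hx
    have h2 : p x * (p x ^ 2 - e ^ 2) < 0 :=
      mul_neg_of_pos_of_neg (by linarith) (by nlinarith)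
    nlinarith [sq_nonneg (p' x)]
  obtain ⟨y, hy, hyx⟩ : ∃ y, e < p y ∧ y ∈ Ioo (0 : ℝ) 1 :=
    ((htop.eventually_gt_atTop e).and (Ioo_mem_nhdsGT one_pos)).exists
  have hc : ContinuousOn p (Ioo 0 1) := fun z hz => (hd z hz).continuousAt.continuousWithinAt
  obtain ⟨z, hz, hpz⟩ := isPreconnected_Ioo.intermediate_value hx hyx hc
    (show e / 2 ∈ Icc (p x) (p y) from ⟨hxe, by linarith⟩)
  have h1 := hode z hz
  rw [hpz] at h1
  nlinarith [sq_nonneg (p' z), pow_pos he 3]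

/-- Differentiating the equation gives p'(p'' - 6p² + 2e²) = 0. For analytic functions on an
interval one factor vanishes identically, and p' does not because p blows up at 0. -/
lemma second_deriv_of_ode (ha : AnalyticOnNhd ℝ p (Ioo 0 1))
    (hd : ∀ x ∈ Ioo (0 : ℝ) 1, HasDerivAt p (p' x) x)
    (hode : ∀ x ∈ Ioo (0 : ℝ) 1, p' x ^ 2 = 4 * p x * (p x ^ 2 - e ^ 2))
    (htop : Tendsto p (𝓝[>] 0) atTop) {x : ℝ} (hx : x ∈ Ioo (0 : ℝ) 1) :
    HasDerivAt p' (6 * p x ^ 2 - 2 * e ^ 2) x := by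
  have heq : EqOn (deriv p) p' (Ioo 0 1) := fun x hx => (hd x hx).deriv
  have ha' : AnalyticOnNhd ℝ p' (Ioo 0 1) := fun x hx =>
    (ha.deriv x hx).congr (heq.eventuallyEq_of_mem (isOpen_Ioo.mem_nhds hx))
  have hprod : ∀ x ∈ Ioo (0 : ℝ) 1,
      p' x * (deriv p' x - (6 * p x ^ 2 - 2 * e ^ 2)) = 0 := by
    intro x hx
    have h1 : HasDerivAt (fun y => p' y ^ 2) (2 * p' x * deriv p' x) x := by
      simpa using (ha' x hx).differentiableAt.hasDerivAt.fun_pow 2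
    have h2 : HasDerivAt (fun y => 4 * p y * (p y ^ 2 - e ^ 2))
        (4 * p' x * (p x ^ 2 - e ^ 2) + 4 * p x * (2 * p x * p' x)) x := by
      simpa using ((hd x hx).const_mul 4).fun_mul (((hd x hx).fun_pow 2).sub_const (e ^ 2))
    have h3 : (fun y => p' y ^ 2) =ᶠ[𝓝 x] fun y => 4 * p y * (p y ^ 2 - e ^ 2) :=
      EqOn.eventuallyEq_of_mem hode (isOpen_Ioo.mem_nhds hx)
    have := h1.unique (h2.congr_of_eventuallyEq h3)
    linear_combination this / 2
  have hq : AnalyticOnNhd ℝ (fun x => deriv p' x - (6 * p x ^ 2 - 2 * e ^ 2)) (Ioo 0 1) :=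
    ha'.deriv.sub ((analyticOnNhd_const.mul (ha.pow 2)).sub analyticOnNhd_const)
  rcases AnalyticOnNhd.eq_zero_or_eq_zero_of_mul_eq_zero ha' hq hprod isPreconnected_Ioo with h | h
  · exfalso
    have hconst : ∀ y ∈ Ioo (0 : ℝ) 1, p y = p (1 / 2) := by
      intro y hy
      refine isOpen_Ioo.is_const_of_deriv_eq_zero isPreconnected_Ioo
        (fun z hz => (hd z hz).differentiableAt.differentiableWithinAt) ?_ hy (by norm_num)
      intro z hz
      rw [(hd z hz).deriv, h z hz]
      rfl
    obtain ⟨y, hy, hyx⟩ := ((htop.eventually_gt_atTop (p (1 / 2))).and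
      (Ioo_mem_nhdsGT one_pos)).exists
    exact hy.ne' (hconst y hyx)
  · have := (ha' x hx).differentiableAt.hasDerivAt
    rwa [show deriv p' x = 6 * p x ^ 2 - 2 * e ^ 2 by linarith [h x hx]] at this

/-- From p ≥ e one gets p'' = 6p² - 2e² > 0, so p' increases strictly to its zero at 1/2. -/
lemma deriv_neg_of_ode (he : 0 < e) (ha : AnalyticOnNhd ℝ p (Ioo 0 1))
    (hd : ∀ x ∈ Ioo (0 : ℝ) 1, HasDerivAt p (p' x) x)
    (hode : ∀ x ∈ Ioo (0 : ℝ) 1, p' x ^ 2 = 4 * p x * (p x ^ 2 - e ^ 2))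
    (htop : Tendsto p (𝓝[>] 0) atTop) (hhalf : p' (1 / 2) = 0)
    {x : ℝ} (hx : x ∈ Ioo (0 : ℝ) (1 / 2)) : p' x < 0 := by
  have h2 : ∀ y ∈ Ioo (0 : ℝ) 1, HasDerivAt p' (6 * p y ^ 2 - 2 * e ^ 2) y := fun y hy =>
    second_deriv_of_ode ha hd hode htop hy
  have hmono : StrictMonoOn p' (Ioo 0 1) := by
    refine strictMonoOn_of_deriv_pos (convex_Ioo 0 1)
      (fun y hy => (h2 y hy).continuousAt.continuousWithinAt) ?_
    intro y hy
    rw [interior_Ioo] at hy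
    rw [(h2 y hy).deriv]
    have := le_of_ode he hd hode htop hy
    nlinarith
  rw [← hhalf]
  exact hmono ⟨hx.1, by linarith [hx.2]⟩ ⟨by norm_num, by norm_num⟩ hx.2

lemma lt_of_ode (he : 0 < e) (ha : AnalyticOnNhd ℝ p (Ioo 0 1))
    (hd : ∀ x ∈ Ioo (0 : ℝ) 1, HasDerivAt p (p' x) x)
    (hode : ∀ x ∈ Ioo (0 : ℝ) 1, p' x ^ 2 = 4 * p x * (p x ^ 2 - e ^ 2))
    (htop : Tendsto p (𝓝[>] 0) atTop) (hhalf : p' (1 / 2) = 0)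
    {x : ℝ} (hx : x ∈ Ioo (0 : ℝ) (1 / 2)) : e < p x := by
  have hx1 : x ∈ Ioo (0 : ℝ) 1 := ⟨hx.1, by linarith [hx.2]⟩
  refine lt_of_le_of_ne (le_of_ode he hd hode htop hx1) fun h => ?_
  have h1 := deriv_neg_of_ode he ha hd hode htop hhalf hx
  have h2 := hode x hx1
  rw [← h] at h2
  nlinarith

lemma image_of_ode (he : 0 < e) (ha : AnalyticOnNhd ℝ p (Ioo 0 1))
    (hd : ∀ x ∈ Ioo (0 : ℝ) 1, HasDerivAt p (p' x) x)
    (hode : ∀ x ∈ Ioo (0 : ℝ) 1, p' x ^ 2 = 4 * p x * (p x ^ 2 - e ^ 2))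
    (htop : Tendsto p (𝓝[>] 0) atTop) (hhalf : p' (1 / 2) = 0) :
    (fun x => (e / p x) ^ 2) '' Ioo 0 (1 / 2) = Ioo 0 1 := by
  ext t
  constructor
  · rintro ⟨x, hx, rfl⟩
    have h1 := lt_of_ode he ha hd hode htop hhalf hx
    have h2 : 0 < e / p x := div_pos he (he.trans h1)
    have h3 : e / p x < 1 := (div_lt_one (he.trans h1)).mpr h1
    exact ⟨by positivity, by simp only; nlinarith⟩
  · rintro ⟨ht0, ht1⟩
    have hst : 0 < √t := Real.sqrt_pos.mpr ht0
    have hst1 : √t < 1 := (Real.sqrt_lt' one_pos).mpr (by simpa using ht1)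
    have hst2 : √t ^ 2 = t := Real.sq_sqrt ht0.le
    have hlt : e < e / √t := by
      rw [lt_div_iff₀ hst]; nlinarith
    have hph : p (1 / 2) = e := by
      have hm : (1 / 2 : ℝ) ∈ Ioo (0 : ℝ) 1 := by norm_num
      have h1 := hode _ hm
      rw [hhalf] at h1
      have h2 := le_of_ode he hd hode htop hm
      have h3 : p (1 / 2) * (p (1 / 2) + e) * (p (1 / 2) - e) = 0 := by linear_combination -h1 / 4
      have h4 : p (1 / 2) * (p (1 / 2) + e) ≠ 0 :=
        (mul_pos (he.trans_le h2) (by linarith)).ne'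
      linarith [(mul_eq_zero.mp h3).resolve_left h4]
    obtain ⟨y, hy, hy0⟩ := ((htop.eventually_gt_atTop (e / √t)).and
      (Ioo_mem_nhdsGT (show (0 : ℝ) < 1 / 2 by norm_num))).exists
    have hc : ContinuousOn p (Ioo 0 1) := fun z hz => (hd z hz).continuousAt.continuousWithinAt
    obtain ⟨x, hx, hpx⟩ := intermediate_value_Ioo' hy0.2.le
      (hc.mono fun z hz => ⟨hy0.1.trans_le hz.1, by linarith [hz.2]⟩)
      (show e / √t ∈ Ioo (p (1 / 2)) (p y) from ⟨by rwa [hph], hy⟩)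
    refine ⟨x, ⟨hy0.1.trans hx.1, hx.2⟩, ?_⟩
    simp only [hpx]
    rw [div_div_cancel₀ he.ne', hst2]

/-- The substitution t = (e/p)² turns the B(1/4, 1/2) integrand into a constant; this is the
pointwise identity behind it. -/
lemma integrand_of_ode {P D : ℝ} (he : 0 < e) (hP : e < P) (hD : D < 0)
    (hode : D ^ 2 = 4 * P * (P ^ 2 - e ^ 2)) :
    |2 * (e / P) * (-(e * D) / P ^ 2)| *
      (((e / P) ^ 2) ^ (-(3 / 4) : ℝ) * (1 - (e / P) ^ 2) ^ (-(1 / 2) : ℝ)) = 4 * √e := by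
  have hP0 : 0 < P := he.trans hP
  -- The roots r, w, v of e/P, 1 - (e/P)² and P make every quantity rational, with D = -2v³w.
  obtain ⟨r, hr⟩ : ∃ r, r = √(e / P) := ⟨_, rfl⟩
  have hr0 : 0 < r := hr ▸ Real.sqrt_pos.mpr (div_pos he hP0)
  have hr2 : r ^ 2 = e / P := hr ▸ Real.sq_sqrt (div_pos he hP0).le
  have heP : e = r ^ 2 * P := by rw [hr2]; field_simp
  have hr1 : 0 < 1 - (r ^ 2) ^ 2 := by
    have : r ^ 2 < 1 := by rw [hr2, div_lt_one hP0]; exact hP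
    nlinarith [sq_nonneg r]
  obtain ⟨w, hw⟩ : ∃ w, w = √(1 - (r ^ 2) ^ 2) := ⟨_, rfl⟩
  have hw0 : 0 < w := hw ▸ Real.sqrt_pos.mpr hr1
  have hw2 : w ^ 2 = 1 - (r ^ 2) ^ 2 := hw ▸ Real.sq_sqrt hr1.le
  obtain ⟨v, hv⟩ : ∃ v, v = √P := ⟨_, rfl⟩
  have hv0 : 0 < v := hv ▸ Real.sqrt_pos.mpr hP0
  have hv2 : P = v ^ 2 := hv ▸ (Real.sq_sqrt hP0.le).symm
  have hse : √e = r * v := by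
    rw [heP, hv2, ← mul_pow, Real.sqrt_sq (by positivity)]
  have hDv : D = -(2 * v ^ 3 * w) := by
    have h1 : D ^ 2 = (2 * v ^ 3 * w) ^ 2 := by
      rw [hode, heP, hv2, mul_pow _ w, hw2]; ring
    rcases sq_eq_sq_iff_eq_or_eq_neg.mp h1 with h | h
    · have : 0 < 2 * v ^ 3 * w := by positivity
      linarith
    · exact h
  have hp1 : ((e / P) ^ 2) ^ (-(3 / 4) : ℝ) = (r ^ 3)⁻¹ := by
    rw [← hr2, ← pow_mul, Real.rpow_neg (by positivity), ← Real.rpow_natCast r (2 * 2),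
      ← Real.rpow_mul hr0.le, ← Real.rpow_natCast r 3]
    norm_num
  have hp2 : (1 - (e / P) ^ 2) ^ (-(1 / 2) : ℝ) = w⁻¹ := by
    rw [← hr2, Real.rpow_neg hr1.le, ← Real.sqrt_eq_rpow, hw]
  rw [hp1, hp2, hse, hDv, heP, hv2, abs_of_pos]
  · field_simp
    norm_num
  · have : 0 < 2 * (r ^ 2 * v ^ 2 / v ^ 2) * (r ^ 2 * v ^ 2 * (2 * v ^ 3 * w) / (v ^ 2) ^ 2) := by
      positivity
    simpa using this

lemma beta_eq_of_ode (he : 0 < e) (ha : AnalyticOnNhd ℝ p (Ioo 0 1))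
    (hd : ∀ x ∈ Ioo (0 : ℝ) 1, HasDerivAt p (p' x) x)
    (hode : ∀ x ∈ Ioo (0 : ℝ) 1, p' x ^ 2 = 4 * p x * (p x ^ 2 - e ^ 2))
    (htop : Tendsto p (𝓝[>] 0) atTop) (hhalf : p' (1 / 2) = 0) :
    ∫ t in Ioo (0 : ℝ) 1, t ^ (-(3 / 4) : ℝ) * (1 - t) ^ (-(1 / 2) : ℝ) = 2 * √e := by
  have hsub : ∀ {x : ℝ}, x ∈ Ioo (0 : ℝ) (1 / 2) → x ∈ Ioo (0 : ℝ) 1 := fun hx =>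
    ⟨hx.1, by linarith [hx.2]⟩
  have hpe := fun x (hx : x ∈ Ioo (0 : ℝ) (1 / 2)) => lt_of_ode he ha hd hode htop hhalf hx
  have hp'neg := fun x (hx : x ∈ Ioo (0 : ℝ) (1 / 2)) =>
    deriv_neg_of_ode he ha hd hode htop hhalf hx
  have hanti : StrictAntiOn p (Ioo 0 (1 / 2)) := by
    refine strictAntiOn_of_deriv_neg (convex_Ioo _ _)
      (fun y hy => (hd y (hsub hy)).continuousAt.continuousWithinAt) ?_
    intro y hy
    rw [interior_Ioo] at hy
    rw [(hd y (hsub hy)).deriv]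
    exact hp'neg y hy
  have hinj : InjOn (fun x => (e / p x) ^ 2) (Ioo 0 (1 / 2)) := by
    intro x hx y hy hxy
    have hx0 := he.trans (hpe x hx)
    have hy0 := he.trans (hpe y hy)
    have h1 : e / p x = e / p y :=
      (pow_left_inj₀ (by positivity) (by positivity) two_ne_zero).mp hxy
    exact hanti.injOn hx hy (by field_simp at h1; exact h1.symm)
  have hderiv : ∀ x ∈ Ioo (0 : ℝ) (1 / 2), HasDerivWithinAt (fun x => (e / p x) ^ 2)
      (2 * (e / p x) * (-(e * p' x) / p x ^ 2)) (Ioo 0 (1 / 2)) x := by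
    intro x hx
    have hx0 := he.trans (hpe x hx)
    have h1 := ((hasDerivAt_const x e).fun_div (hd x (hsub hx)) hx0.ne').fun_pow 2
    simpa using h1.hasDerivWithinAt
  have hcv := MeasureTheory.integral_image_eq_integral_abs_deriv_smul measurableSet_Ioo hderiv hinj
    (fun t => t ^ (-(3 / 4) : ℝ) * (1 - t) ^ (-(1 / 2) : ℝ))
  rw [image_of_ode he ha hd hode htop hhalf] at hcv
  rw [hcv, MeasureTheory.setIntegral_congr_fun (g := fun _ => 4 * √e) measurableSet_Ioo]
  · simp
    ring
  · intro x hx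
    exact integrand_of_ode he (hpe x hx) (hp'neg x hx) (hode x (hsub hx))

end LemniscateODE

/-! ### The Weierstrass function on the real axis and the value of g₂. -/

namespace GaussLattice

open Set Topology

open Complex in
lemma conj_derivWeierstrassP (x : ℝ) :
    (starRingEnd ℂ) (gaussPeriodPair.derivWeierstrassP x)
      = gaussPeriodPair.derivWeierstrassP x := by
  rw [PeriodPair.derivWeierstrassP, map_neg, Complex.conj_tsum, ← conjEquiv.tsum_eq]
  simp [conjEquiv, map_ofNat (starRingEnd ℂ) 2]

/-- The invariant `g₂` of the Gaussian lattice as a real number. -/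
noncomputable def invariant : ℝ := gaussPeriodPair.g₂.re

lemma ofReal_invariant : (invariant : ℂ) = gaussPeriodPair.g₂ := by
  rw [invariant]
  apply Complex.conj_eq_iff_re.mp
  rw [PeriodPair.g₂, map_mul, conj_G, map_ofNat]

lemma ofReal_re_weierstrassP (x : ℝ) :
    ((gaussPeriodPair.weierstrassP x).re : ℂ) = gaussPeriodPair.weierstrassP x :=
  Complex.conj_eq_iff_re.mp (conj_weierstrassP x)

lemma ofReal_re_derivWeierstrassP (x : ℝ) :
    ((gaussPeriodPair.derivWeierstrassP x).re : ℂ) = gaussPeriodPair.derivWeierstrassP x :=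
  Complex.conj_eq_iff_re.mp (conj_derivWeierstrassP x)

lemma hasDerivAt_re_weierstrassP {x : ℝ} (hx : x ∈ Ioo (0 : ℝ) 1) :
    HasDerivAt (fun y : ℝ => (gaussPeriodPair.weierstrassP y).re)
      (gaussPeriodPair.derivWeierstrassP x).re x := by
  have h := (gaussPeriodPair.analyticOnNhd_weierstrassP x
    (ofReal_notMem hx.1 hx.2)).differentiableAt.hasDerivAt
  rw [PeriodPair.deriv_weierstrassP] at h
  exact h.real_of_complex

lemma re_derivWeierstrassP_sq {x : ℝ} (hx : x ∈ Ioo (0 : ℝ) 1) :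
    (gaussPeriodPair.derivWeierstrassP x).re ^ 2
      = 4 * (gaussPeriodPair.weierstrassP x).re ^ 3
        - invariant * (gaussPeriodPair.weierstrassP x).re := by
  have h := gaussPeriodPair.derivWeierstrassP_sq x (ofReal_notMem hx.1 hx.2)
  rw [PeriodPair.g₃, G_six, ← ofReal_invariant, ← ofReal_re_weierstrassP,
    ← ofReal_re_derivWeierstrassP] at h
  apply Complex.ofReal_injective
  push_cast
  rw [h]
  ring

lemma tendsto_re_weierstrassP :
    Tendsto (fun y : ℝ => (gaussPeriodPair.weierstrassP y).re) (𝓝[>] 0) atTop := by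
  have hc : ContinuousAt (fun y : ℝ => (gaussPeriodPair.weierstrassPExcept 0 y).re) 0 := by
    have h1 : ContinuousAt (gaussPeriodPair.weierstrassPExcept 0) ((0 : ℝ) : ℂ) := by
      rw [Complex.ofReal_zero]
      exact (gaussPeriodPair.analyticAt_weierstrassPExcept 0).continuousAt
    exact Complex.continuous_re.continuousAt.comp
      (h1.comp (f := fun y : ℝ => (y : ℂ)) Complex.continuous_ofReal.continuousAt)
  have hinv : Tendsto (fun y : ℝ => (y⁻¹) ^ 2) (𝓝[>] 0) atTop :=
    (tendsto_pow_atTop two_ne_zero).comp tendsto_inv_nhdsGT_zero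
  refine (hinv.atTop_add (hc.tendsto.mono_left nhdsWithin_le_nhds)).congr' ?_
  filter_upwards [self_mem_nhdsWithin] with y hy
  have hy0 : (y : ℂ) ≠ 0 := by exact_mod_cast (ne_of_gt hy : y ≠ 0)
  have h := gaussPeriodPair.ite_eq_one_sub_sq_mul_weierstrassP 0 (zero_mem _) y
  rw [if_neg hy0] at h
  have h2 : gaussPeriodPair.weierstrassP y
      = ((y⁻¹ ^ 2 : ℝ) : ℂ) + gaussPeriodPair.weierstrassPExcept 0 y := by
    push_cast
    field_simp
    simpa [add_comm, mul_comm] using h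
  rw [h2, Complex.add_re, Complex.ofReal_re]

/-- The derivative is odd and 1-periodic, so its value at 1/2 is its own negative. -/
lemma derivWeierstrassP_half : gaussPeriodPair.derivWeierstrassP (1 / 2 : ℝ) = 0 := by
  have h1 : gaussPeriodPair.derivWeierstrassP (-((1 / 2 : ℝ) : ℂ) + (1 : ℂ))
      = gaussPeriodPair.derivWeierstrassP (-((1 / 2 : ℝ) : ℂ)) :=
    gaussPeriodPair.derivWeierstrassP_add_coe _ ⟨1, mem_iff.mpr ⟨1, 0, by simp⟩⟩
  rw [PeriodPair.derivWeierstrassP_neg,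
    show (-((1 / 2 : ℝ) : ℂ) + (1 : ℂ)) = ((1 / 2 : ℝ) : ℂ) by push_cast; ring] at h1
  exact CharZero.eq_neg_self_iff.mp h1

lemma beta_quarter_half :
    ∫ t in Ioo (0 : ℝ) 1, t ^ (-(3 / 4) : ℝ) * (1 - t) ^ (-(1 / 2) : ℝ)
      = Real.Gamma (1 / 4) ^ 2 / √(2 * Real.pi) := by
  have h := Complex.betaIntegral_eq_Gamma_mul_div (1 / 4) (1 / 2) (by norm_num) (by norm_num)
  have hI : Complex.betaIntegral (1 / 4) (1 / 2) = ((∫ t in Ioo (0 : ℝ) 1,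
      t ^ (-(3 / 4) : ℝ) * (1 - t) ^ (-(1 / 2) : ℝ) : ℝ) : ℂ) := by
    rw [Complex.betaIntegral, intervalIntegral.integral_of_le zero_le_one,
      MeasureTheory.integral_Ioc_eq_integral_Ioo, ← integral_complex_ofReal]
    refine MeasureTheory.setIntegral_congr_fun measurableSet_Ioo fun t ht => ?_
    rw [Complex.ofReal_mul, Complex.ofReal_cpow ht.1.le, Complex.ofReal_cpow (by linarith [ht.2])]
    push_cast
    norm_num
  have hG : Real.Gamma (1 / 4) * Real.Gamma (3 / 4) = Real.pi * √2 := by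
    have := Real.Gamma_mul_Gamma_one_sub (1 / 4)
    rw [show (1 : ℝ) - 1 / 4 = 3 / 4 by norm_num, show Real.pi * (1 / 4) = Real.pi / 4 by ring,
      Real.sin_pi_div_four] at this
    rw [this]
    have h2 : √2 ^ 2 = 2 := Real.sq_sqrt (by norm_num)
    field_simp
    exact h2.symm
  rw [hI, show (1 / 4 : ℂ) + 1 / 2 = ((3 / 4 : ℝ) : ℂ) by push_cast; norm_num,
    show (1 / 4 : ℂ) = ((1 / 4 : ℝ) : ℂ) by push_cast; rfl,
    show (1 / 2 : ℂ) = ((1 / 2 : ℝ) : ℂ) by push_cast; rfl, Complex.Gamma_ofReal,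
    Complex.Gamma_ofReal, Complex.Gamma_ofReal, Real.Gamma_one_half_eq] at h
  have h' : (∫ t in Ioo (0 : ℝ) 1, t ^ (-(3 / 4) : ℝ) * (1 - t) ^ (-(1 / 2) : ℝ))
      = Real.Gamma (1 / 4) * √Real.pi / Real.Gamma (3 / 4) := by
    exact_mod_cast h
  have h34 : 0 < Real.Gamma (3 / 4) := Real.Gamma_pos_of_pos (by norm_num)
  have hpi : √Real.pi ^ 2 = Real.pi := Real.sq_sqrt Real.pi_pos.le
  have hs : 0 < √Real.pi := Real.sqrt_pos.mpr Real.pi_pos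
  rw [h', Real.sqrt_mul (by norm_num)]
  field_simp
  rw [hpi, hG]

/-- Taking e = √g₂/2 puts the Weierstrass equation with g₃ = 0 in the form studied above, so B(1/4,
1/2) = 2√e. -/
lemma invariant_eq (hpos : 0 < invariant) :
    invariant = Real.Gamma (1 / 4) ^ 8 / (16 * Real.pi ^ 2) := by
  have he : 0 < √invariant / 2 := by positivity
  have hsq : √invariant ^ 2 = invariant := Real.sq_sqrt hpos.le
  have h := LemniscateODE.beta_eq_of_ode he
    (p := fun y : ℝ => (gaussPeriodPair.weierstrassP y).re)
    (p' := fun y : ℝ => (gaussPeriodPair.derivWeierstrassP y).re)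
    (fun x hx => (gaussPeriodPair.analyticOnNhd_weierstrassP x
      (ofReal_notMem hx.1 hx.2)).re_ofReal)
    (fun x hx => hasDerivAt_re_weierstrassP hx)
    (fun x hx => by
      rw [re_derivWeierstrassP_sq hx, div_pow, hsq]
      ring)
    tendsto_re_weierstrassP (by simp only [derivWeierstrassP_half, Complex.zero_re])
  rw [beta_quarter_half] at h
  -- The eighth power clears all nested square roots and leaves an equation for g₂².
  have h2 : (Real.Gamma (1 / 4) ^ 2 / √(2 * Real.pi)) ^ 8 = (2 * √(√invariant / 2)) ^ 8 := by rw [h]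
  rw [div_pow, mul_pow, show (8 : ℕ) = 2 * 4 from rfl, pow_mul √(2 * Real.pi),
    pow_mul √(√invariant / 2), Real.sq_sqrt (by positivity), Real.sq_sqrt he.le, div_pow,
    show (4 : ℕ) = 2 * 2 from rfl, pow_mul √invariant, hsq] at h2
  have hpi := Real.pi_pos
  have h3 : (Real.Gamma (1 / 4) ^ 8 / (16 * Real.pi ^ 2)) ^ 2 = invariant ^ 2 := by
    rw [div_pow]
    field_simp at h2 ⊢
    nlinarith [h2]
  have hG : 0 < Real.Gamma (1 / 4) := Real.Gamma_pos_of_pos (by norm_num)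
  exact ((pow_left_inj₀ (by positivity) hpos.le two_ne_zero).mp h3).symm

end GaussLattice

/-! ### The value η(i) and the Lambert series. -/

namespace GaussLattice

/-- The product `∏ (1 - e^{-2πm})` over `m ≥ 1`. -/
noncomputable def eulerProd : ℝ := ∏' n : ℕ, (1 - Real.exp (-(2 * Real.pi)) ^ (n + 1))

lemma exp_lt_one : Real.exp (-(2 * Real.pi)) < 1 := by
  rw [Real.exp_lt_one_iff]
  linarith [Real.pi_pos]

lemma pow_lt_one (n : ℕ) : Real.exp (-(2 * Real.pi)) ^ (n + 1) < 1 :=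
  pow_lt_one₀ (Real.exp_pos _).le exp_lt_one (by omega)

lemma summable_log : Summable fun n : ℕ => Real.log (1 - Real.exp (-(2 * Real.pi)) ^ (n + 1)) := by
  have h : Summable fun n : ℕ => -Real.exp (-(2 * Real.pi)) ^ (n + 1) :=
    ((summable_nat_add_iff 1).mpr
      (summable_geometric_of_lt_one (Real.exp_pos _).le exp_lt_one)).neg
  simpa [sub_eq_add_neg] using Real.summable_log_one_add_of_summable h

lemma exp_tsum_log :
    Real.exp (∑' n : ℕ, Real.log (1 - Real.exp (-(2 * Real.pi)) ^ (n + 1))) = eulerProd :=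
  Real.rexp_tsum_eq_tprod (fun n => sub_pos.mpr (pow_lt_one n)) summable_log

lemma eulerProd_pos : 0 < eulerProd := exp_tsum_log ▸ Real.exp_pos _

open Complex in
lemma eta_I : ModularForm.eta I = ((Real.exp (-(Real.pi / 12)) * eulerProd : ℝ) : ℂ) := by
  have hm : Multipliable fun n : ℕ => (1 - Real.exp (-(2 * Real.pi)) ^ (n + 1)) :=
    Real.multipliable_of_summable_log (fun n => sub_pos.mpr (pow_lt_one n)) summable_log
  rw [ModularForm.eta, eulerProd, Complex.ofReal_mul]
  congr 1
  · simp only [Function.Periodic.qParam, Complex.ofReal_exp]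
    congr 1
    push_cast
    linear_combination (Real.pi : ℂ) / 12 * I_mul_I
  · have := hm.map_tprod Complex.ofRealHom Complex.continuous_ofReal
    simp only [Complex.ofRealHom_eq_coe] at this
    rw [this]
    refine tprod_congr fun n => ?_
    rw [ModularForm.eta_q_eq_pow]
    push_cast
    congr 3
    linear_combination 2 * (Real.pi : ℂ) * I_mul_I

/-- Since E₆(i) = 0, the identity 1728 Δ = E₄³ - E₆² with Δ = η²⁴ loses its last term. -/
lemma E₄_cube : (ModularForm.E₄ UpperHalfPlane.I) ^ 3
    = ((1728 * (Real.exp (-(Real.pi / 12)) * eulerProd) ^ 24 : ℝ) : ℂ) := by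
  have h := ModularForm.discriminant_eq_E₄_cube_sub_E₆_sq UpperHalfPlane.I
  have h6 : ModularForm.E₆ UpperHalfPlane.I = 0 := by
    have h1 := G_eq (show 3 ≤ 6 by norm_num)
    rw [G_six] at h1
    have hz : riemannZeta (6 : ℕ) ≠ 0 :=
      riemannZeta_ne_zero_of_one_lt_re (by norm_num)
    exact (mul_eq_zero.mp h1.symm).resolve_left (mul_ne_zero two_ne_zero hz)
  rw [h6, ModularForm.discriminant, UpperHalfPlane.coe_I, eta_I] at h
  push_cast at h ⊢
  linear_combination -1728 * h

lemma invariant_E₄ : (invariant : ℂ) = 4 * Real.pi ^ 4 / 3 * ModularForm.E₄ UpperHalfPlane.I := by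
  rw [ofReal_invariant, PeriodPair.g₂, G_eq (show 3 ≤ 4 by norm_num)]
  push_cast
  rw [riemannZeta_four]
  ring

lemma invariant_cube : invariant ^ 3
    = (4 * Real.pi ^ 4 / 3) ^ 3 * (1728 * (Real.exp (-(Real.pi / 12)) * eulerProd) ^ 24) := by
  apply Complex.ofReal_injective
  rw [Complex.ofReal_mul, ← E₄_cube, Complex.ofReal_pow, invariant_E₄]
  push_cast
  ring

lemma invariant_pos : 0 < invariant := by
  have h := invariant_cube
  have h1 : 0 < invariant ^ 3 := by
    rw [h]
    have := eulerProd_pos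
    positivity
  exact (Odd.pow_pos_iff (by decide)).mp h1

/-- The left side is η(i). Its 24th power follows by equating the two expressions for g₂³, and
positivity selects the root. -/
lemma exp_mul_eulerProd :
    Real.exp (-(Real.pi / 12)) * eulerProd = Real.Gamma (1 / 4) / (2 * Real.pi ^ (3 / 4 : ℝ)) := by
  have h := invariant_cube
  have hG : 0 < Real.Gamma (1 / 4) := Real.Gamma_pos_of_pos (by norm_num)
  have hpi := Real.pi_pos
  have hE := eulerProd_pos
  rw [invariant_eq invariant_pos] at h
  refine (pow_left_inj₀ (by positivity) (by positivity) (show 24 ≠ 0 by norm_num)).mp ?_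
  have hp : (Real.pi ^ (3 / 4 : ℝ)) ^ 24 = Real.pi ^ 18 := by
    rw [← Real.rpow_natCast, ← Real.rpow_mul hpi.le, ← Real.rpow_natCast]
    norm_num
  rw [div_pow, mul_pow 2, hp]
  generalize (Real.exp (-(Real.pi / 12)) * eulerProd) ^ 24 = X at h ⊢
  field_simp at h ⊢
  nlinarith [h]

lemma tsum_log :
    ∑' n : ℕ, Real.log (1 - Real.exp (-(2 * Real.pi)) ^ (n + 1))
      = Real.pi / 12 + Real.log (Real.Gamma (1 / 4)) - Real.log 2 - 3 / 4 * Real.log Real.pi := by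
  have hG : 0 < Real.Gamma (1 / 4) := Real.Gamma_pos_of_pos (by norm_num)
  have hpi := Real.pi_pos
  have h := congrArg Real.log exp_mul_eulerProd
  rw [← exp_tsum_log, ← Real.exp_add, Real.log_exp, Real.log_div (by positivity) (by positivity),
    Real.log_mul (by norm_num) (by positivity), Real.log_rpow hpi] at h
  linarith

/-- Expand each logarithm as a power series and exchange the order of the nonnegative double sum. -/
lemma hasSum_lambert_neg_log {q : ℝ} (hq0 : 0 < q) (hq1 : q < 1) :
    HasSum (fun j : ℕ => q ^ (j + 1) * (1 - q ^ (j + 1))⁻¹ / ((j : ℝ) + 1))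
      (∑' m : ℕ, -Real.log (1 - q ^ (m + 1))) := by
  have hlt : ∀ m : ℕ, q ^ (m + 1) < 1 := fun m => pow_lt_one₀ hq0.le hq1 (by omega)
  obtain ⟨F, hFdef⟩ : ∃ F : ℕ × ℕ → ℝ,
      ∀ m j : ℕ, F (m, j) = (q ^ (m + 1)) ^ (j + 1) / ((j : ℝ) + 1) :=
    ⟨fun x => (q ^ (x.1 + 1)) ^ (x.2 + 1) / ((x.2 : ℝ) + 1), fun _ _ => rfl⟩
  have hF : Summable F := by
    have hg := summable_geometric_of_lt_one hq0.le hq1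
    refine Summable.of_nonneg_of_le (fun x => ?_) (fun x => ?_)
      (hg.mul_of_nonneg hg (fun _ => by positivity) (fun _ => by positivity))
    · obtain ⟨m, j⟩ := x
      rw [hFdef]
      positivity
    · obtain ⟨m, j⟩ := x
      rw [hFdef, ← pow_mul, ← pow_add]
      refine (div_le_self (by positivity) (by linarith [Nat.cast_nonneg (α := ℝ) j])).trans ?_
      exact pow_le_pow_of_le_one hq0.le hq1.le (by simp only; nlinarith [Nat.zero_le (m * j)])
  have h1 : ∀ m : ℕ, HasSum (fun j => F (m, j)) (-Real.log (1 - q ^ (m + 1))) := fun m => by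
    simp only [hFdef]
    exact Real.hasSum_pow_div_log_of_abs_lt_one
      (by rw [abs_of_pos (by positivity)]; exact hlt m)
  have h2 : ∀ j : ℕ, HasSum (fun m => F (m, j))
      (q ^ (j + 1) * (1 - q ^ (j + 1))⁻¹ / ((j : ℝ) + 1)) := by
    intro j
    simp only [hFdef]
    have hg := ((hasSum_geometric_of_lt_one (r := q ^ (j + 1)) (by positivity)
      (hlt j)).mul_left (q ^ (j + 1))).div_const ((j : ℝ) + 1)
    refine hg.congr_fun fun m => ?_
    rw [← pow_mul, ← pow_mul, ← pow_add]
    congr 2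
    ring
  have hswap : HasSum (fun x : ℕ × ℕ => F (x.2, x.1)) (∑' x, F x) :=
    (Equiv.prodComm ℕ ℕ).hasSum_iff.mpr hF.hasSum
  rw [(hF.hasSum.prod_fiberwise h1).tsum_eq]
  exact hswap.prod_fiberwise h2

lemma hasSum_lambert :
    HasSum (fun j : ℕ => 1 / (((j : ℝ) + 1) * (Real.exp (2 * Real.pi * (j + 1)) - 1)))
      (Real.log 2 + 3 / 4 * Real.log Real.pi - Real.pi / 12 - Real.log (Real.Gamma (1 / 4))) := by
  have h := hasSum_lambert_neg_log (Real.exp_pos _) exp_lt_one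
  rw [tsum_neg, tsum_log] at h
  convert h using 1
  · funext j
    have he : Real.exp (2 * Real.pi * (j + 1)) = (Real.exp (-(2 * Real.pi)) ^ (j + 1))⁻¹ := by
      rw [← Real.exp_nat_mul, ← Real.exp_neg]
      push_cast
      congr 1
      ring
    rw [he]
    have h0 : 1 - Real.exp (-(2 * Real.pi)) ^ (j + 1) ≠ 0 := (sub_pos.mpr (pow_lt_one j)).ne'
    have h1 : Real.exp (-(2 * Real.pi)) ^ (j + 1) ≠ 0 := (pow_pos (Real.exp_pos _) _).ne'
    generalize Real.exp (-(2 * Real.pi)) ^ (j + 1) = y at h0 h1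
    field_simp
  · ring

end GaussLattice

/-! ### Exact reduction of the double sum to single sums. -/

namespace SquareLattice

open Finset

lemma phi_squarePhi (n j k : ℕ) :
    phi squarePhi (dualPoint (Pi.basisFun ℝ (Fin 2)) n j k)
      = ((1 / 2 * (Real.cos (2 * Real.pi * j / n) + Real.cos (2 * Real.pi * k / n)) : ℝ) : ℂ) := by
  have hne : (Pi.single 0 1 : Fin 2 → ℝ) ≠ Pi.single 1 1 := by
    intro h
    simpa using congrFun h 0
  have hcos : ∀ x : ℝ, Complex.exp (Complex.I * (x : ℂ)) + Complex.exp (Complex.I * ((-x : ℝ) : ℂ))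
      = 2 * ((Real.cos x : ℝ) : ℂ) := by
    intro x
    rw [Complex.ofReal_cos, Complex.two_cos]
    push_cast
    ring_nf
  rw [phi, squarePhi, Finset.card_pair hne, Finset.sum_pair hne]
  simp only [map_neg]
  rw [hcos, hcos]
  simp [dualPoint]
  ring

lemma latticeSum_squarePhi (n : ℕ) :
    latticeSum squarePhi (Pi.basisFun ℝ (Fin 2)) n = ((squareSum n : ℝ) : ℂ) := by
  rw [latticeSum, squareSum, Complex.ofReal_sum]
  refine Finset.sum_congr rfl fun p _ => ?_
  rw [phi_squarePhi]
  push_cast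
  rfl

/-- Write 1/(x - ζᵏ) as a geometric sum over xⁿ - 1; orthogonality of the roots of unity keeps only
the exponent n - 1. -/
lemma sum_inv_sub_root {n : ℕ} (hn : 0 < n) {ζ : ℂ} (hζ : IsPrimitiveRoot ζ n) {x : ℂ}
    (hx : x ^ n ≠ 1) : ∑ k ∈ range n, (x - ζ ^ k)⁻¹ = n * x ^ (n - 1) / (x ^ n - 1) := by
  have hx1 : x ^ n - 1 ≠ 0 := sub_ne_zero.mpr hx
  have hterm : ∀ k ∈ range n, (x - ζ ^ k)⁻¹
      = (∑ m ∈ range n, x ^ m * (ζ ^ (n - 1 - m)) ^ k) / (x ^ n - 1) := by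
    intro k _
    have hk : (ζ ^ k) ^ n = 1 := by rw [← pow_mul, mul_comm, pow_mul, hζ.pow_eq_one, one_pow]
    have hne : x - ζ ^ k ≠ 0 := fun h => hx (by rw [sub_eq_zero.mp h, hk])
    have := (Commute.all x (ζ ^ k)).geom_sum₂_mul n
    rw [hk] at this
    rw [eq_div_iff hx1, ← this, mul_comm, mul_assoc, mul_inv_cancel₀ hne, mul_one]
    refine sum_congr rfl fun m _ => ?_
    rw [← pow_mul, ← pow_mul, mul_comm k]
  rw [sum_congr rfl hterm, ← sum_div, sum_comm]
  congr 1
  simp_rw [← mul_sum]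
  rw [sum_eq_single_of_mem (n - 1) (by simp; omega)]
  · simp [mul_comm]
  · intro m hm hmn
    have hm' := mem_range.mp hm
    have hw : ζ ^ (n - 1 - m) ≠ 1 := hζ.pow_ne_one_of_pos_of_lt (by omega) (by omega)
    have hg := mul_geom_sum (ζ ^ (n - 1 - m)) n
    rw [← pow_mul, mul_comm (n - 1 - m), pow_mul, hζ.pow_eq_one, one_pow, sub_self] at hg
    rw [(mul_eq_zero.mp hg).resolve_left (sub_ne_zero.mpr hw), mul_zero]

lemma denom_pos {x : ℝ} (hx : 1 < x) (θ : ℝ) : 0 < x ^ 2 - 2 * x * Real.cos θ + 1 := by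
  nlinarith [Real.cos_le_one θ, mul_pos (sub_pos.mpr hx) (sub_pos.mpr hx)]

/-- Each term is 1/|x - ζᵏ|², which equals (2x Re(1/(x - ζᵏ)) - 1)/(x² - 1). -/
lemma sum_poisson_kernel {n : ℕ} (hn : 0 < n) {x : ℝ} (hx : 1 < x) :
    ∑ k ∈ range n, (x ^ 2 - 2 * x * Real.cos (2 * Real.pi * k / n) + 1)⁻¹
      = n * (x ^ n + 1) / ((x ^ 2 - 1) * (x ^ n - 1)) := by
  have hζ := Complex.isPrimitiveRoot_exp n hn.ne'
  have hxn : 1 < x ^ n := one_lt_pow₀ hx hn.ne'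
  have h := congrArg Complex.re (sum_inv_sub_root hn hζ (x := (x : ℂ))
    (by exact_mod_cast hxn.ne'))
  have hr : ((n : ℂ) * (x : ℂ) ^ (n - 1) / ((x : ℂ) ^ n - 1)).re
      = n * x ^ (n - 1) / (x ^ n - 1) := by
    rw [← Complex.ofReal_re (n * x ^ (n - 1) / (x ^ n - 1))]
    push_cast
    rfl
  rw [hr, Complex.re_sum] at h
  have hterm : ∀ k ∈ range n, (x ^ 2 - 2 * x * Real.cos (2 * Real.pi * k / n) + 1)⁻¹
      = (2 * x * (((x : ℂ) - Complex.exp (2 * Real.pi * Complex.I / n) ^ k)⁻¹).re - 1)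
        / (x ^ 2 - 1) := by
    intro k _
    have he : Complex.exp (2 * Real.pi * Complex.I / n) ^ k
        = Complex.exp (((2 * Real.pi * k / n : ℝ) : ℂ) * Complex.I) := by
      rw [← Complex.exp_nat_mul]
      congr 1
      push_cast
      ring
    have hd := denom_pos hx (2 * Real.pi * k / n)
    have hx2 : x ^ 2 - 1 ≠ 0 := by nlinarith
    have hns : Complex.normSq ((x : ℂ) - Complex.exp (((2 * Real.pi * k / n : ℝ) : ℂ) * Complex.I))
        = x ^ 2 - 2 * x * Real.cos (2 * Real.pi * k / n) + 1 := by
      rw [Complex.normSq_apply, Complex.sub_re, Complex.sub_im, Complex.exp_ofReal_mul_I_re,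
        Complex.exp_ofReal_mul_I_im, Complex.ofReal_re, Complex.ofReal_im]
      linear_combination Real.sin_sq_add_cos_sq (2 * Real.pi * k / n)
    rw [he, Complex.inv_re, hns, Complex.sub_re, Complex.exp_ofReal_mul_I_re, Complex.ofReal_re]
    generalize Real.cos (2 * Real.pi * k / n) = c at hd
    rw [eq_div_iff hx2]
    linear_combination -(mul_inv_cancel₀ hd.ne')
  rw [sum_congr rfl hterm, ← sum_div, sum_sub_distrib, ← mul_sum, h]
  have hx2 : x ^ 2 - 1 ≠ 0 := by nlinarith
  have hxn' : x ^ n - 1 ≠ 0 := by linarith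
  have hpow : x ^ n = x * x ^ (n - 1) := by
    rw [← pow_succ']
    congr 1
    omega
  simp only [sum_const, card_range, nsmul_eq_mul, mul_one]
  field_simp
  rw [hpow]
  ring

lemma sum_mul_sub (n : ℕ) : ∑ m ∈ range n, (m : ℝ) * (n - m) = n * (n ^ 2 - 1) / 6 := by
  have h1 : ∀ N : ℕ, ∑ m ∈ range N, (m : ℝ) = N * (N - 1) / 2 := by
    intro N
    induction N with
    | zero => simp
    | succ k ih => rw [sum_range_succ, ih]; push_cast; ring
  have h2 : ∀ N : ℕ, ∑ m ∈ range N, (m : ℝ) ^ 2 = N * (N - 1) * (2 * N - 1) / 6 := by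
    intro N
    induction N with
    | zero => simp
    | succ k ih => rw [sum_range_succ, ih]; push_cast; ring
  have h3 : ∀ m ∈ range n, (m : ℝ) * (n - m) = n * m - m ^ 2 := fun m _ => by ring
  rw [sum_congr rfl h3, sum_sub_distrib, ← mul_sum, h1, h2]
  ring

/-- Dropping k = 0 subtracts the pole 1/(x - 1)². The numerator is rewritten as ∑ (xᵐ - 1)(xⁿ⁻ᵐ -
1), so that the factor (x - 1)² cancels and the result is continuous at x = 1, as the next limit
requires. -/
lemma sum_poisson_kernel_Ico {n : ℕ} (hn : 0 < n) {x : ℝ} (hx : 1 < x) :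
    ∑ k ∈ Ico 1 n, (x ^ 2 - 2 * x * Real.cos (2 * Real.pi * k / n) + 1)⁻¹
      = (∑ m ∈ range n, (∑ i ∈ range m, x ^ i) * ∑ i ∈ range (n - m), x ^ i)
        / ((x + 1) * ∑ i ∈ range n, x ^ i) := by
  have h := sum_poisson_kernel hn hx
  rw [range_eq_Ico, sum_eq_sum_Ico_succ_bot hn] at h
  have hx1 : x - 1 ≠ 0 := by linarith
  have hgeom : ∀ m, ∑ i ∈ range m, x ^ i = (x ^ m - 1) / (x - 1) := fun m => geom_sum_eq hx.ne' m
  have hsum : ∑ m ∈ range n, (x ^ m - 1) * (x ^ (n - m) - 1)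
      = n * (x ^ n + 1) - (x + 1) * ∑ i ∈ range n, x ^ i := by
    have h1 : ∀ m ∈ range n, (x ^ m - 1) * (x ^ (n - m) - 1) = x ^ n + 1 - x ^ m - x ^ (n - m) := by
      intro m hm
      have : x ^ n = x ^ m * x ^ (n - m) := by
        rw [← pow_add]
        congr 1
        have := mem_range.mp hm
        omega
      rw [this]
      ring
    have h2 : ∑ m ∈ range n, x ^ (n - m) = x * ∑ i ∈ range n, x ^ i := by
      rw [mul_sum, ← sum_range_reflect]
      refine sum_congr rfl fun m hm => ?_
      have := mem_range.mp hm
      rw [← pow_succ']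
      congr 1
      omega
    rw [sum_congr rfl h1, sum_sub_distrib, sum_sub_distrib, h2]
    simp
    ring
  have hxn : 1 < x ^ n := one_lt_pow₀ hx hn.ne'
  have hxn' : x ^ n - 1 ≠ 0 := by linarith
  have hx2 : x + 1 ≠ 0 := by linarith
  have hT : ∑ m ∈ range n, (∑ i ∈ range m, x ^ i) * ∑ i ∈ range (n - m), x ^ i
      = (n * (x ^ n + 1) - (x + 1) * ((x ^ n - 1) / (x - 1))) / (x - 1) ^ 2 := by
    rw [← hgeom n, ← hsum, sum_div]
    refine sum_congr rfl fun m _ => ?_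
    rw [hgeom, hgeom]
    field_simp
  rw [hT, hgeom]
  have h0 : (x ^ 2 - 2 * x * Real.cos (2 * Real.pi * (0 : ℕ) / n) + 1)⁻¹ = ((x - 1) ^ 2)⁻¹ := by
    simp
    ring
  rw [h0, show x ^ 2 - 1 = (x - 1) * (x + 1) by ring] at h
  rw [zero_add] at h
  rw [eq_sub_of_add_eq' h]
  field_simp

lemma sum_inv_one_sub_cos {n : ℕ} (hn : 0 < n) :
    ∑ k ∈ Ico 1 n, (2 - 2 * Real.cos (2 * Real.pi * k / n))⁻¹ = ((n : ℝ) ^ 2 - 1) / 12 := by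
  have hne : ∀ k ∈ Ico 1 n, 2 - 2 * Real.cos (2 * Real.pi * k / n) ≠ 0 := by
    intro k hk h
    have hk' := mem_Ico.mp hk
    have hn' : (0 : ℝ) < n := by exact_mod_cast hn
    have hk1 : (0 : ℝ) < k := by exact_mod_cast hk'.1
    have hkn : (k : ℝ) < n := by exact_mod_cast hk'.2
    have hpos : 0 < 2 * Real.pi * k / n := by positivity
    have hlt : 2 * Real.pi * k / n < 2 * Real.pi := by
      rw [div_lt_iff₀ hn']
      exact mul_lt_mul_of_pos_left hkn (by positivity)
    have := (Real.cos_eq_one_iff_of_lt_of_lt (by linarith) hlt).mp (by linarith)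
    linarith
  have hL : Tendsto (fun x : ℝ => ∑ k ∈ Ico 1 n,
      (x ^ 2 - 2 * x * Real.cos (2 * Real.pi * k / n) + 1)⁻¹) (nhdsWithin 1 (Set.Ioi 1))
      (nhds (∑ k ∈ Ico 1 n, (2 - 2 * Real.cos (2 * Real.pi * k / n))⁻¹)) := by
    refine tendsto_finsetSum _ fun k hk => ?_
    have hc : Continuous fun x : ℝ => x ^ 2 - 2 * x * Real.cos (2 * Real.pi * k / n) + 1 := by
      fun_prop
    have := hc.tendsto 1
    rw [show (1 : ℝ) ^ 2 - 2 * 1 * Real.cos (2 * Real.pi * k / n) + 1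
      = 2 - 2 * Real.cos (2 * Real.pi * k / n) by ring] at this
    exact (this.inv₀ (hne k hk)).mono_left nhdsWithin_le_nhds
  have hn0 : (n : ℝ) ≠ 0 := by exact_mod_cast hn.ne'
  have hR : Tendsto (fun x : ℝ =>
      (∑ m ∈ range n, (∑ i ∈ range m, x ^ i) * ∑ i ∈ range (n - m), x ^ i)
        / ((x + 1) * ∑ i ∈ range n, x ^ i)) (nhdsWithin 1 (Set.Ioi 1))
      (nhds (((n : ℝ) ^ 2 - 1) / 12)) := by
    have hc1 : Continuous fun x : ℝ =>
        ∑ m ∈ range n, (∑ i ∈ range m, x ^ i) * ∑ i ∈ range (n - m), x ^ i := by fun_prop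
    have hc2 : Continuous fun x : ℝ => (x + 1) * ∑ i ∈ range n, x ^ i := by fun_prop
    have h1 := (hc1.tendsto 1).div (hc2.tendsto 1) (by simp; omega)
    have hv : ∑ m ∈ range n, (∑ i ∈ range m, (1 : ℝ) ^ i) * ∑ i ∈ range (n - m), (1 : ℝ) ^ i
        = n * ((n : ℝ) ^ 2 - 1) / 6 := by
      rw [← sum_mul_sub]
      refine sum_congr rfl fun m hm => ?_
      have := (mem_range.mp hm).le
      simp [Nat.cast_sub this]
    rw [hv] at h1
    have hval : n * ((n : ℝ) ^ 2 - 1) / 6 / ((1 + 1) * ∑ i ∈ range n, (1 : ℝ) ^ i)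
        = ((n : ℝ) ^ 2 - 1) / 12 := by
      have hs : ∑ i ∈ range n, (1 : ℝ) ^ i = n := by simp
      rw [hs]
      field_simp
      ring
    rw [hval] at h1
    exact h1.mono_left nhdsWithin_le_nhds
  refine tendsto_nhds_unique hL (hR.congr' ?_)
  filter_upwards [self_mem_nhdsWithin] with x hx
  exact (sum_poisson_kernel_Ico hn hx).symm

/-- The function `1 / (sin θ √(1 + sin² θ))`. -/
noncomputable def kern (θ : ℝ) : ℝ := 1 / (Real.sin θ * √(1 + Real.sin θ ^ 2))

/-- With s = sin θ, w = √(1 + s²) and x = (s + w)² = exp(2 arsinh s), the denominator times 4x is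
the Poisson denominator in x. Then (xⁿ + 1)/(xⁿ - 1) = 1 + 2/(xⁿ - 1). -/
lemma sum_row {n : ℕ} (hn : 0 < n) {θ : ℝ} (hθ : 0 < Real.sin θ) :
    ∑ k ∈ range n, 1 / (1 - 1 / 2 * (Real.cos (2 * θ) + Real.cos (2 * Real.pi * k / n)))
      = n * (kern θ + 2 * (kern θ / (Real.exp (2 * n * Real.arsinh (Real.sin θ)) - 1))) := by
  obtain ⟨s, hs⟩ : ∃ s, s = Real.sin θ := ⟨_, rfl⟩
  obtain ⟨w, hw⟩ : ∃ w, w = √(1 + s ^ 2) := ⟨_, rfl⟩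
  rw [kern, ← hs, ← hw]
  rw [← hs] at hθ
  have hw2 : w ^ 2 = 1 + s ^ 2 := hw ▸ Real.sq_sqrt (by positivity)
  have hw0 : 0 < w := hw ▸ Real.sqrt_pos.mpr (by positivity)
  have hw1 : 1 < w := by nlinarith
  have hx : 1 < (s + w) ^ 2 := by nlinarith
  have he : Real.exp (2 * n * Real.arsinh s) = ((s + w) ^ 2) ^ n := by
    rw [← pow_mul, show 2 * (n : ℝ) * Real.arsinh s = ((2 * n : ℕ) : ℝ) * Real.arsinh s by
      push_cast; ring, Real.exp_nat_mul, Real.exp_arsinh, hw]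
  have hcos : Real.cos (2 * θ) = 1 - 2 * s ^ 2 := by
    rw [Real.cos_two_mul, hs]
    linear_combination 2 * Real.sin_sq_add_cos_sq θ
  have hxn : 1 < ((s + w) ^ 2) ^ n := one_lt_pow₀ hx hn.ne'
  have hrow : ∀ k ∈ range n,
      1 / (1 - 1 / 2 * (Real.cos (2 * θ) + Real.cos (2 * Real.pi * k / n)))
        = 4 * (s + w) ^ 2 * (((s + w) ^ 2) ^ 2
          - 2 * (s + w) ^ 2 * Real.cos (2 * Real.pi * k / n) + 1)⁻¹ := by
    intro k _
    have hd := denom_pos hx (2 * Real.pi * k / n)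
    have h4 : 4 * (s + w) ^ 2
        * (1 - 1 / 2 * (Real.cos (2 * θ) + Real.cos (2 * Real.pi * k / n)))
        = ((s + w) ^ 2) ^ 2 - 2 * (s + w) ^ 2 * Real.cos (2 * Real.pi * k / n) + 1 := by
      rw [hcos]
      have : ((s + w) ^ 2) ^ 2 + 1 = (2 + 4 * s ^ 2) * (s + w) ^ 2 := by
        have h1 : (s + w) ^ 2 = 2 * s * (s + w) + 1 := by linear_combination hw2
        have h2 : w ^ 4 = (1 + s ^ 2) ^ 2 := by rw [← hw2]; ring
        have h3 : w ^ 3 = (1 + s ^ 2) * w := by rw [← hw2]; ring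
        have : ((s + w) ^ 2) ^ 2 + 1 = s ^ 4 + 4 * s ^ 3 * w + 6 * s ^ 2 * w ^ 2
          + 4 * s * w ^ 3 + w ^ 4 + 1 := by ring
        rw [this, h2, h3]
        have : (s + w) ^ 2 = s ^ 2 + 2 * s * w + w ^ 2 := by ring
        rw [this, hw2]
        ring
      linear_combination -this
    rw [← h4] at hd ⊢
    have hd' : 0 < 1 - 1 / 2 * (Real.cos (2 * θ) + Real.cos (2 * Real.pi * k / n)) :=
      pos_of_mul_pos_right hd (by positivity)
    generalize 1 - 1 / 2 * (Real.cos (2 * θ) + Real.cos (2 * Real.pi * k / n)) = y at hd'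
    field_simp
  rw [sum_congr rfl hrow, ← mul_sum, sum_poisson_kernel hn hx, he]
  have hy : ((s + w) ^ 2) ^ n - 1 ≠ 0 := by linarith
  generalize ((s + w) ^ 2) ^ n = y at hy
  have hq : ((s + w) ^ 2) ^ 2 - 1 = 4 * s * w * (s + w) ^ 2 := by
    linear_combination (w ^ 2 - s ^ 2 + 1) * hw2
  rw [hq]
  have : s + w ≠ 0 := by positivity
  field_simp
  ring

lemma squareSum_eq {n : ℕ} (hn : 0 < n) :
    squareSum n = ((n : ℝ) ^ 2 - 1) / 3
      + n * ∑ j ∈ Ico 1 n, kern (Real.pi * j / n)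
      + 2 * n * ∑ j ∈ Ico 1 n, kern (Real.pi * j / n)
          / (Real.exp (2 * n * Real.arsinh (Real.sin (Real.pi * j / n))) - 1) := by
  -- At (0, 0) the summand is 1/0 = 0 by convention, so the erased point can be restored.
  rw [squareSum, Finset.sum_erase _ (by norm_num), Finset.sum_product]
  conv_lhs => rw [range_eq_Ico]
  rw [sum_eq_sum_Ico_succ_bot hn, zero_add, add_assoc]
  congr 1
  · rw [sum_eq_sum_Ico_succ_bot hn, zero_add]
    have h := sum_inv_one_sub_cos hn
    have h2 : ∀ k ∈ Ico 1 n, 1 / (1 - 1 / 2 * (Real.cos (2 * Real.pi * (0 : ℕ) / n)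
        + Real.cos (2 * Real.pi * k / n))) = 4 * (2 - 2 * Real.cos (2 * Real.pi * k / n))⁻¹ := by
      intro k _
      rw [show 2 - 2 * Real.cos (2 * Real.pi * k / n)
        = 4 * (1 - 1 / 2 * (1 + Real.cos (2 * Real.pi * k / n))) by ring, mul_inv]
      simp
    rw [sum_congr rfl h2, ← mul_sum, h]
    simp
    ring
  · rw [mul_sum, mul_sum, ← sum_add_distrib]
    refine sum_congr rfl fun j hj => ?_
    have hj' := mem_Ico.mp hj
    have hn' : (0 : ℝ) < n := by exact_mod_cast hn
    have hj0 : (0 : ℝ) < j := by exact_mod_cast hj'.1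
    have hjn : (j : ℝ) < n := by exact_mod_cast hj'.2
    have hsin : 0 < Real.sin (Real.pi * j / n) := by
      refine Real.sin_pos_of_pos_of_lt_pi (by positivity) ?_
      rw [div_lt_iff₀ hn']
      exact mul_lt_mul_of_pos_left hjn Real.pi_pos
    have h := sum_row hn hsin
    rw [show 2 * (Real.pi * j / n) = 2 * Real.pi * j / n by ring] at h
    rw [range_eq_Ico] at h
    simp only
    rw [h]
    ring

end SquareLattice

/-! ### Harmonic numbers with error O(1/n²). -/

namespace SquareLattice

open Finset Topology

/-- The trapezoidal bound for ∫ dt/t over [a, a + 1], obtained by comparing the series in 1/(2a + 1)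
with a geometric series. -/
lemma log_one_add_inv_le {a : ℝ} (ha : 0 < a) :
    Real.log (1 + a⁻¹) ≤ (1 / a + 1 / (a + 1)) / 2 := by
  have h := Real.hasSum_log_one_add_inv ha
  obtain ⟨y, hy⟩ : ∃ y, y = 1 / (2 * a + 1) := ⟨_, rfl⟩
  rw [← hy] at h
  have hy0 : 0 < y := hy ▸ by positivity
  have hy1 : y < 1 := by rw [hy, div_lt_one (by positivity)]; linarith
  have hg := (hasSum_geometric_of_lt_one (sq_nonneg y) (by nlinarith)).mul_left (2 * y)
  have hle := hasSum_le (fun k => ?_) h hg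
  · refine hle.trans_eq ?_
    have h1 : 1 - y ^ 2 = 4 * a * (a + 1) / (2 * a + 1) ^ 2 := by
      rw [hy]
      field_simp
      ring
    rw [h1, hy]
    field_simp
    ring
  · have hk : 1 / (2 * (k : ℝ) + 1) ≤ 1 := by
      rw [div_le_one (by positivity)]
      linarith [Nat.cast_nonneg (α := ℝ) k]
    calc 2 * (1 / (2 * (k : ℝ) + 1)) * y ^ (2 * k + 1) ≤ 2 * 1 * y ^ (2 * k + 1) := by gcongr
      _ = 2 * y * (y ^ 2) ^ k := by rw [pow_succ, pow_mul]; ring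

lemma le_log_one_add_inv {a : ℝ} (ha : 0 < a) : 2 / (2 * a + 1) ≤ Real.log (1 + a⁻¹) := by
  have h := Real.hasSum_log_one_add_inv ha
  have := le_hasSum h 0 (fun k _ => by positivity)
  refine le_trans (le_of_eq ?_) this
  simp
  ring

/-- `H_{m+1} - log (m+1) - 1/(2(m+1))`. -/
noncomputable def harmonicDefect (m : ℕ) : ℝ :=
  (harmonic (m + 1) : ℝ) - Real.log ((m : ℝ) + 1) - 1 / (2 * ((m : ℝ) + 1))

lemma harmonicDefect_succ (m : ℕ) : harmonicDefect (m + 1) - harmonicDefect m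
    = (1 / ((m : ℝ) + 1) + 1 / ((m : ℝ) + 1 + 1)) / 2 - Real.log (1 + ((m : ℝ) + 1)⁻¹) := by
  have h0 : (0 : ℝ) < (m : ℝ) + 1 := by positivity
  have hlog : Real.log (1 + ((m : ℝ) + 1)⁻¹)
      = Real.log ((m : ℝ) + 1 + 1) - Real.log ((m : ℝ) + 1) := by
    rw [← Real.log_div (by positivity) (by positivity)]
    congr 1
    field_simp
  rw [harmonicDefect, harmonicDefect, harmonic_succ (m + 1), hlog]
  push_cast
  field_simp
  ring

lemma monotone_harmonicDefect : Monotone harmonicDefect := by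
  refine monotone_nat_of_le_succ fun m => ?_
  have := harmonicDefect_succ m
  have := log_one_add_inv_le (a := (m : ℝ) + 1) (by positivity)
  linarith

lemma antitone_harmonicDefect_add :
    Antitone fun m : ℕ => harmonicDefect m + 1 / ((m : ℝ) + 1) ^ 2 := by
  refine antitone_nat_of_succ_le fun m => ?_
  have h1 := harmonicDefect_succ m
  have h2 := le_log_one_add_inv (a := (m : ℝ) + 1) (by positivity)
  have h3 : (1 / ((m : ℝ) + 1) + 1 / ((m : ℝ) + 1 + 1)) / 2 - 2 / (2 * ((m : ℝ) + 1) + 1)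
      ≤ 1 / ((m : ℝ) + 1) ^ 2 - 1 / ((m : ℝ) + 1 + 1) ^ 2 := by
    have hm : (0 : ℝ) ≤ m := Nat.cast_nonneg m
    obtain ⟨a, ha⟩ : ∃ a : ℝ, a = m + 1 := ⟨_, rfl⟩
    have ha1 : 1 ≤ a := by linarith
    rw [← ha]
    have e1 : (1 / a + 1 / (a + 1)) / 2 - 2 / (2 * a + 1)
        = 1 / (2 * a * (a + 1) * (2 * a + 1)) := by
      field_simp
      ring
    have e2 : 1 / a ^ 2 - 1 / (a + 1) ^ 2 = (2 * a + 1) / (a ^ 2 * (a + 1) ^ 2) := by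
      field_simp
      ring
    rw [e1, e2, div_le_div_iff₀ (by positivity) (by positivity)]
    have : a ^ 2 * (a + 1) ^ 2 ≤ (2 * a * (a + 1) * (2 * a + 1)) * (2 * a + 1) := by
      have h5 : a * (a + 1) ≤ 2 * (2 * a + 1) * (2 * a + 1) := by nlinarith
      have h6 : 0 ≤ a * (a + 1) := by positivity
      nlinarith [mul_le_mul_of_nonneg_left h5 h6]
    linarith
  push_cast
  linarith

lemma tendsto_harmonicDefect :
    Tendsto harmonicDefect atTop (𝓝 Real.eulerMascheroniConstant) := by
  have h1 := (tendsto_add_atTop_iff_nat 1).mpr Real.tendsto_harmonic_sub_log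
  have h2 : Tendsto (fun m : ℕ => 1 / (2 : ℝ) * (1 / ((m : ℝ) + 1))) atTop (𝓝 (1 / 2 * 0)) :=
    tendsto_one_div_add_atTop_nhds_zero_nat.const_mul _
  have h3 := h1.sub h2
  rw [mul_zero, sub_zero] at h3
  refine h3.congr fun m => ?_
  rw [harmonicDefect]
  push_cast
  field_simp

/-- The defect increases to γ, while the defect plus 1/(m + 1)² decreases to γ. The sum stops at n -
1, which turns the usual +1/(2n) into -1/(2n). -/
lemma abs_sum_inv_sub {n : ℕ} (hn : 0 < n) :
    |∑ j ∈ Ico 1 n, 1 / (j : ℝ)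
      - (Real.log n + Real.eulerMascheroniConstant - 1 / (2 * n))| ≤ 1 / (n : ℝ) ^ 2 := by
  obtain ⟨m, rfl⟩ : ∃ m, n = m + 1 := ⟨n - 1, by omega⟩
  have hsum : ∑ j ∈ Ico 1 (m + 1), 1 / (j : ℝ) = (harmonic (m + 1) : ℝ) - 1 / ((m : ℝ) + 1) := by
    rw [harmonic_succ, harmonic_eq_sum_Icc]
    push_cast
    simp [Ico_add_one_right_eq_Icc]
  have h1 := monotone_harmonicDefect.ge_of_tendsto tendsto_harmonicDefect m
  have hlim : Tendsto (fun m : ℕ => harmonicDefect m + 1 / ((m : ℝ) + 1) ^ 2) atTop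
      (𝓝 (Real.eulerMascheroniConstant + 0 ^ 2)) := by
    refine (tendsto_harmonicDefect.add
      ((tendsto_one_div_add_atTop_nhds_zero_nat (𝕜 := ℝ)).pow 2)).congr fun m => ?_
    simp
  have h2 := antitone_harmonicDefect_add.le_of_tendsto hlim m
  have h3 : ∑ j ∈ Ico 1 (m + 1), 1 / (j : ℝ)
      - (Real.log ((m : ℝ) + 1) + Real.eulerMascheroniConstant - 1 / (2 * ((m : ℝ) + 1)))
      = harmonicDefect m - Real.eulerMascheroniConstant := by
    rw [hsum, harmonicDefect]
    field_simp
    ring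
  push_cast
  rw [h3, abs_le]
  constructor
  · norm_num at h2 ⊢
    linarith
  · have : 0 < 1 / ((m : ℝ) + 1) ^ 2 := by positivity
    linarith

end SquareLattice

/-! ### The sum of `kern`: removal of the poles and the trapezoidal rule. -/

namespace SquareLattice

open Topology Set

/-- `θ · kern θ`, extended analytically to a neighbourhood of `0`. -/
noncomputable def scaledKern (θ : ℝ) : ℝ := (Real.sinc θ * √(1 + Real.sin θ ^ 2))⁻¹

lemma analyticAt_dslope {f : ℝ → ℝ} {a : ℝ} (hf : AnalyticAt ℝ f a) :
    AnalyticAt ℝ (dslope f a) a := by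
  obtain ⟨p, hp⟩ := hf
  exact ⟨_, hp.has_fpower_series_dslope_fslope⟩

lemma analyticAt_scaledKern : AnalyticAt ℝ scaledKern 0 := by
  have h1 : AnalyticAt ℝ Real.sinc 0 := by
    rw [Real.sinc_eq_dslope]
    exact analyticAt_dslope Real.analyticAt_sin
  have h2 : AnalyticAt ℝ (fun θ : ℝ => 1 + Real.sin θ ^ 2) 0 :=
    analyticAt_const.add (Real.analyticAt_sin.pow 2)
  have h3 : AnalyticAt ℝ (fun θ : ℝ => √(1 + Real.sin θ ^ 2)) 0 :=
    (ContDiffAt.sqrt (h2.contDiffAt (n := ⊤)) (by simp)).analyticAt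
  exact (h1.mul h3).inv (by simp)

lemma scaledKern_zero : scaledKern 0 = 1 := by simp [scaledKern]

lemma scaledKern_of_ne {θ : ℝ} (h : θ ≠ 0) : scaledKern θ = θ * kern θ := by
  rw [scaledKern, kern, Real.sinc_of_ne_zero h, mul_inv, inv_div, one_div, mul_inv]
  ring

/-- The function is even. Hence `kern θ - 1/θ` tends to 0 at 0, which explains the endpoint value
-1/π of `regKern`. -/
lemma deriv_scaledKern : deriv scaledKern 0 = 0 := by
  have he : (fun x => scaledKern (-x)) = scaledKern := by
    funext x
    simp [scaledKern]
  have h := deriv_comp_neg scaledKern 0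
  rw [he, neg_zero] at h
  linarith

/-- `kern θ - 1/θ - 1/(π - θ)`, extended by continuity to `0` and `π`. -/
noncomputable def regKern (θ : ℝ) : ℝ :=
  if θ = 0 ∨ θ = Real.pi then -1 / Real.pi else kern θ - 1 / θ - 1 / (Real.pi - θ)

lemma kern_pi_sub (θ : ℝ) : kern (Real.pi - θ) = kern θ := by simp [kern]

lemma regKern_pi_sub (θ : ℝ) : regKern (Real.pi - θ) = regKern θ := by
  have h : (Real.pi - θ = 0 ∨ Real.pi - θ = Real.pi) ↔ (θ = 0 ∨ θ = Real.pi) := by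
    constructor
    · rintro (h | h)
      · right; linarith
      · left; linarith
    · rintro (h | h)
      · right; linarith
      · left; linarith
  simp only [regKern, h, kern_pi_sub]
  split_ifs
  · rfl
  · rw [sub_sub_cancel]
    ring

lemma regKern_of_mem {θ : ℝ} (h : θ ∈ Ioo 0 Real.pi) :
    regKern θ = kern θ - 1 / θ - 1 / (Real.pi - θ) :=
  if_neg (by rintro (h' | h') <;> linarith [h.1, h.2])

lemma contDiffAt_regKern_zero : ContDiffAt ℝ 2 regKern 0 := by
  have h1 : ContDiffAt ℝ 2 (fun θ => dslope scaledKern 0 θ - 1 / (Real.pi - θ)) 0 := by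
    have h2 : ContDiffAt ℝ 2 (dslope scaledKern 0) 0 :=
      (analyticAt_dslope analyticAt_scaledKern).contDiffAt
    have h3 : ContDiffAt ℝ 2 (fun θ : ℝ => 1 / (Real.pi - θ)) 0 :=
      contDiffAt_const.div (contDiffAt_const.sub contDiffAt_id) (by simp)
    exact h2.sub h3
  refine h1.congr_of_eventuallyEq ?_
  filter_upwards [Iio_mem_nhds Real.pi_pos] with θ hθ
  rcases eq_or_ne θ 0 with rfl | h0
  · simp [regKern, deriv_scaledKern, neg_div]
  · rw [regKern, if_neg (by rintro (h | h); exacts [h0 h, hθ.ne h]), dslope_of_ne _ h0,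
      slope_def_field, scaledKern_zero, scaledKern_of_ne h0, sub_zero]
    field_simp

lemma contDiffAt_regKern {θ : ℝ} (h : θ ∈ Icc 0 Real.pi) : ContDiffAt ℝ 2 regKern θ := by
  rcases h.1.eq_or_lt with h0 | h0
  · exact h0 ▸ contDiffAt_regKern_zero
  rcases h.2.eq_or_lt with hpi | hpi
  · have h1 : regKern = fun θ => regKern (Real.pi - θ) := funext fun θ => (regKern_pi_sub θ).symm
    rw [h1, hpi]
    have h2 : ContDiffAt ℝ 2 (fun θ : ℝ => Real.pi - θ) Real.pi :=
      contDiffAt_const.sub contDiffAt_id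
    refine ContDiffAt.comp (g := regKern) Real.pi ?_ h2
    rw [sub_self]
    exact contDiffAt_regKern_zero
  · have hs : 0 < Real.sin θ := Real.sin_pos_of_pos_of_lt_pi h0 hpi
    have hk : ContDiffAt ℝ 2 kern θ := by
      refine contDiffAt_const.div (Real.contDiff_sin.contDiffAt.mul
        (ContDiffAt.sqrt ?_ (by positivity))) (by positivity)
      exact contDiffAt_const.add (Real.contDiff_sin.contDiffAt.pow 2)
    have h1 : ContDiffAt ℝ 2 (fun θ => kern θ - 1 / θ - 1 / (Real.pi - θ)) θ :=
      (hk.sub (contDiffAt_const.div contDiffAt_id h0.ne')).sub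
        (contDiffAt_const.div (contDiffAt_const.sub contDiffAt_id) (sub_pos.mpr hpi).ne')
    refine h1.congr_of_eventuallyEq ?_
    filter_upwards [Ioo_mem_nhds h0 hpi] with x hx
    exact regKern_of_mem hx

lemma contDiffOn_regKern : ContDiffOn ℝ 2 regKern (Icc 0 Real.pi) := fun _ h =>
  (contDiffAt_regKern h).contDiffWithinAt

/-- An antiderivative of `kern`. -/
noncomputable def kernPrim (θ : ℝ) : ℝ :=
  (Real.log (√(1 + Real.sin θ ^ 2) - Real.cos θ)
    - Real.log (√(1 + Real.sin θ ^ 2) + Real.cos θ)) / 2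

lemma abs_cos_lt {θ : ℝ} (hs : 0 < Real.sin θ) : |Real.cos θ| < √(1 + Real.sin θ ^ 2) := by
  rw [Real.lt_sqrt (abs_nonneg _), sq_abs]
  nlinarith [Real.sin_sq_add_cos_sq θ]

lemma hasDerivAt_kernPrim {θ : ℝ} (hs : 0 < Real.sin θ) : HasDerivAt kernPrim (kern θ) θ := by
  have hlt := abs_lt.mp (abs_cos_lt hs)
  have hw2 : √(1 + Real.sin θ ^ 2) ^ 2 = 1 + Real.sin θ ^ 2 := Real.sq_sqrt (by positivity)
  have hw0 : 0 < √(1 + Real.sin θ ^ 2) := Real.sqrt_pos.mpr (by positivity)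
  have hw : HasDerivAt (fun x => √(1 + Real.sin x ^ 2))
      (Real.sin θ * Real.cos θ / √(1 + Real.sin θ ^ 2)) θ := by
    have h1 := (((Real.hasDerivAt_sin θ).fun_pow 2).const_add 1).sqrt (by positivity)
    convert h1 using 1
    field_simp
    simp
    ring
  have hc := Real.hasDerivAt_cos θ
  have h : HasDerivAt kernPrim _ θ := (((hw.fun_sub hc).log (by linarith)).fun_sub
    ((hw.fun_add hc).log (by linarith))).div_const 2
  refine h.congr_deriv ?_
  rw [kern]
  have hm : √(1 + Real.sin θ ^ 2) - Real.cos θ ≠ 0 := by linarith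
  have hp : √(1 + Real.sin θ ^ 2) + Real.cos θ ≠ 0 := by linarith
  have hc2 : Real.cos θ ^ 2 = 1 - Real.sin θ ^ 2 := by linarith [Real.sin_sq_add_cos_sq θ]
  generalize √(1 + Real.sin θ ^ 2) = w at *
  generalize Real.cos θ = u at *
  generalize Real.sin θ = s at *
  have hprod : (w - u) * (w + u) = 2 * s ^ 2 := by linear_combination hw2 - hc2
  have e1 : (s * u / w - -s) / (w - u) - (s * u / w + -s) / (w + u)
      = s / w * (((w + u) ^ 2 + (w - u) ^ 2) / ((w - u) * (w + u))) := by
    field_simp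
    ring
  rw [e1, hprod, show (w + u) ^ 2 + (w - u) ^ 2 = 4 by linear_combination 2 * hw2 + 2 * hc2]
  field_simp
  norm_num

/-- An antiderivative of `regKern` on `(0, π)`. -/
noncomputable def regPrim (θ : ℝ) : ℝ := kernPrim θ - Real.log θ + Real.log (Real.pi - θ)

lemma hasDerivAt_regPrim {θ : ℝ} (h : θ ∈ Ioo 0 Real.pi) :
    HasDerivAt regPrim (regKern θ) θ := by
  rw [regKern_of_mem h]
  have h1 := hasDerivAt_kernPrim (Real.sin_pos_of_pos_of_lt_pi h.1 h.2)
  have h2 := Real.hasDerivAt_log h.1.ne'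
  have h3 := ((hasDerivAt_id θ).const_sub Real.pi).log (sub_pos.mpr h.2).ne'
  have h : HasDerivAt regPrim _ θ := (h1.fun_sub h2).fun_add h3
  refine h.congr_deriv ?_
  simp
  ring

/-- Since √(1 + sin² θ) - cos θ = 2 sin² θ/(√(1 + sin² θ) + cos θ), the logarithmic singularity at 0
cancels log θ and leaves log sinc θ. -/
lemma regPrim_eq {θ : ℝ} (h : θ ∈ Ioo 0 Real.pi) :
    regPrim θ = Real.log 2 / 2 + Real.log (Real.sinc θ)
      - Real.log (√(1 + Real.sin θ ^ 2) + Real.cos θ) + Real.log (Real.pi - θ) := by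
  have hs := Real.sin_pos_of_pos_of_lt_pi h.1 h.2
  have hlt := abs_lt.mp (abs_cos_lt hs)
  have hw2 : √(1 + Real.sin θ ^ 2) ^ 2 = 1 + Real.sin θ ^ 2 := Real.sq_sqrt (by positivity)
  have hp : 0 < √(1 + Real.sin θ ^ 2) + Real.cos θ := by linarith
  have hm : √(1 + Real.sin θ ^ 2) - Real.cos θ
      = 2 * Real.sin θ ^ 2 / (√(1 + Real.sin θ ^ 2) + Real.cos θ) := by
    rw [eq_div_iff hp.ne']
    linear_combination hw2 - Real.sin_sq_add_cos_sq θ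
  rw [regPrim, kernPrim, hm, Real.log_div (by positivity) hp.ne',
    Real.log_mul (by norm_num) (by positivity), Real.log_pow, Real.sinc_of_ne_zero h.1.ne',
    Real.log_div hs.ne' h.1.ne']
  push_cast
  ring

lemma tendsto_regPrim_zero :
    Tendsto regPrim (𝓝[>] 0) (𝓝 (Real.log Real.pi - Real.log 2 / 2)) := by
  have h1 : ContinuousAt (fun θ => Real.log 2 / 2 + Real.log (Real.sinc θ)
      - Real.log (√(1 + Real.sin θ ^ 2) + Real.cos θ) + Real.log (Real.pi - θ)) 0 := by
    have hs : ContinuousAt Real.sinc 0 := Real.continuous_sinc.continuousAt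
    have hw : ContinuousAt (fun θ => √(1 + Real.sin θ ^ 2) + Real.cos θ) 0 := by fun_prop
    have hp : ContinuousAt (fun θ => Real.pi - θ) 0 := by fun_prop
    exact ((continuousAt_const.add (hs.log (by simp))).sub (hw.log (by norm_num))).add
      (hp.log (by simp))
  have h2 := h1.tendsto.mono_left (nhdsWithin_le_nhds (s := Ioi 0))
  have hv : Real.log 2 / 2 + Real.log (Real.sinc 0)
      - Real.log (√(1 + Real.sin 0 ^ 2) + Real.cos 0) + Real.log (Real.pi - 0)
      = Real.log Real.pi - Real.log 2 / 2 := by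
    norm_num
    ring
  rw [hv] at h2
  refine h2.congr' ?_
  filter_upwards [Ioo_mem_nhdsGT Real.pi_pos] with θ hθ
  exact (regPrim_eq hθ).symm

lemma regPrim_pi_sub (θ : ℝ) : regPrim (Real.pi - θ) = -regPrim θ := by
  simp only [regPrim, kernPrim, Real.sin_pi_sub, Real.cos_pi_sub, sub_sub_cancel, sub_neg_eq_add]
  rw [← sub_eq_add_neg]
  ring

lemma tendsto_regPrim_pi :
    Tendsto regPrim (𝓝[<] Real.pi) (𝓝 (-(Real.log Real.pi - Real.log 2 / 2))) := by
  have h1 : Tendsto (fun θ => Real.pi - θ) (𝓝[<] Real.pi) (𝓝[>] 0) := by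
    refine tendsto_nhdsWithin_iff.mpr ⟨?_, ?_⟩
    · have : Continuous fun θ => Real.pi - θ := by fun_prop
      have h := this.tendsto Real.pi
      rw [sub_self] at h
      exact h.mono_left nhdsWithin_le_nhds
    · filter_upwards [self_mem_nhdsWithin] with θ hθ
      exact sub_pos.mpr (mem_Iio.mp hθ)
  refine (tendsto_regPrim_zero.comp h1).neg.congr fun θ => ?_
  simp only [Function.comp_apply]
  rw [regPrim_pi_sub, neg_neg]

lemma integral_regKern :
    ∫ θ in (0 : ℝ)..Real.pi, regKern θ = Real.log 2 - 2 * Real.log Real.pi := by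
  rw [intervalIntegral.integral_eq_sub_of_hasDerivAt_of_tendsto Real.pi_pos
    (fun θ h => hasDerivAt_regPrim h) ?_ tendsto_regPrim_zero tendsto_regPrim_pi]
  · ring
  · refine ContinuousOn.intervalIntegrable ?_
    rw [uIcc_of_le Real.pi_pos.le]
    exact contDiffOn_regKern.continuousOn

lemma exists_bound_iteratedDerivWithin {f : ℝ → ℝ} {a b : ℝ} (hab : a < b)
    (hf : ContDiffOn ℝ 2 f (Icc a b)) :
    ∃ ζ, ∀ x, |iteratedDerivWithin 2 f (Icc a b) x| ≤ ζ := by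
  have hc := hf.continuousOn_iteratedDerivWithin le_rfl (uniqueDiffOn_Icc hab)
  obtain ⟨ζ, hζ⟩ := isCompact_Icc.exists_bound_of_continuousOn hc
  refine ⟨max ζ 0, fun x => ?_⟩
  by_cases hx : x ∈ Icc a b
  · exact (hζ x hx).trans (le_max_left _ _)
  -- Off the closed interval `derivWithin` takes its default value 0, so the bound holds for every
  -- x.
  · have : ¬ AccPt x (𝓟 (Icc a b)) := fun h =>
      hx (isClosed_iff_accPt.mp isClosed_Icc x h)
    rw [show (2 : ℕ) = 1 + 1 from rfl, iteratedDerivWithin_succ,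
      derivWithin_zero_of_not_accPt this, abs_zero]
    exact le_max_right _ _

-- The term 1/π compensates the two half-weighted endpoint values -1/π of the trapezoidal rule.
open Finset in
lemma exists_abs_sum_regKern_sub :
    ∃ C, ∀ n : ℕ, 0 < n → |∑ j ∈ Finset.Ico 1 n, regKern (Real.pi * j / n)
      - (n / Real.pi * (Real.log 2 - 2 * Real.log Real.pi) + 1 / Real.pi)| ≤ C / n := by
  obtain ⟨ζ, hζ⟩ := exists_bound_iteratedDerivWithin Real.pi_pos contDiffOn_regKern
  refine ⟨Real.pi ^ 2 * ζ / 12, fun n hn => ?_⟩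
  have hn' : (0 : ℝ) < n := by exact_mod_cast hn
  have hpi := Real.pi_pos
  have h := trapezoidal_error_le_of_c2 (f := regKern) (a := 0) (b := Real.pi) (ζ := ζ) (N := n)
    (by rw [uIcc_of_le hpi.le]; exact contDiffOn_regKern)
    (by rw [uIcc_of_le hpi.le]; exact hζ) hn
  rw [trapezoidal_error, trapezoidal_integral, integral_regKern, sub_zero, abs_of_pos hpi] at h
  have hsum : ∑ k ∈ range (n - 1), regKern (0 + ((k : ℝ) + 1) * Real.pi / n)
      = ∑ j ∈ Finset.Ico 1 n, regKern (Real.pi * j / n) := by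
    rw [sum_Ico_eq_sum_range]
    refine sum_congr rfl fun k _ => ?_
    congr 1
    push_cast
    ring
  have h0 : regKern 0 = -1 / Real.pi := if_pos (Or.inl rfl)
  have h1 : regKern Real.pi = -1 / Real.pi := if_pos (Or.inr rfl)
  rw [hsum, h0, h1] at h
  generalize ∑ j ∈ Finset.Ico 1 n, regKern (Real.pi * j / n) = S at h ⊢
  have e : S - (n / Real.pi * (Real.log 2 - 2 * Real.log Real.pi) + 1 / Real.pi)
      = n / Real.pi * (Real.pi / n * ((-1 / Real.pi + -1 / Real.pi) / 2 + S)
        - (Real.log 2 - 2 * Real.log Real.pi)) := by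
    field_simp
    ring
  rw [e, abs_mul, abs_of_pos (by positivity)]
  calc n / Real.pi * _ ≤ n / Real.pi * (Real.pi ^ 3 * ζ / (12 * n ^ 2)) := by gcongr
    _ = Real.pi ^ 2 * ζ / 12 / n := by field_simp

/-- The two poles give the same harmonic sum by j ↦ n - j. Their -1/(2n) corrections total -1/π and
cancel the +1/π of the regular part. -/
lemma exists_abs_sum_kern_sub :
    ∃ C, ∀ n : ℕ, 0 < n → |∑ j ∈ Finset.Ico 1 n, kern (Real.pi * j / n)
      - (2 * n / Real.pi * (Real.log n + Real.eulerMascheroniConstant)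
        + n / Real.pi * (Real.log 2 - 2 * Real.log Real.pi))| ≤ C / n := by
  obtain ⟨C, hC⟩ := exists_abs_sum_regKern_sub
  refine ⟨C + 2 / Real.pi, fun n hn => ?_⟩
  have hn' : (0 : ℝ) < n := by exact_mod_cast hn
  have hpi := Real.pi_pos
  have hterm : ∀ j ∈ Finset.Ico 1 n, kern (Real.pi * j / n) = n / Real.pi * (1 / (j : ℝ))
      + n / Real.pi * (1 / ((n - j : ℕ) : ℝ)) + regKern (Real.pi * j / n) := by
    intro j hj
    have hj' := Finset.mem_Ico.mp hj
    have hj0 : (0 : ℝ) < j := by exact_mod_cast hj'.1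
    have hjn : (j : ℝ) < n := by exact_mod_cast hj'.2
    have hnj : (n : ℝ) - j ≠ 0 := by linarith
    rw [regKern_of_mem, Nat.cast_sub hj'.2.le]
    · rw [show Real.pi - Real.pi * j / n = Real.pi * (n - j) / n by field_simp]
      field_simp
      ring
    · refine ⟨by positivity, ?_⟩
      rw [div_lt_iff₀ hn']
      exact mul_lt_mul_of_pos_left hjn hpi
  have hrefl : ∑ j ∈ Finset.Ico 1 n, 1 / ((n - j : ℕ) : ℝ) = ∑ j ∈ Finset.Ico 1 n, 1 / (j : ℝ) := by
    have := Finset.sum_Ico_reflect (fun j : ℕ => 1 / (j : ℝ)) 1 (show n ≤ n + 1 by omega)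
    simpa [show n + 1 - n = 1 by omega] using this
  rw [Finset.sum_congr rfl hterm, Finset.sum_add_distrib, Finset.sum_add_distrib, ← Finset.mul_sum,
    ← Finset.mul_sum, hrefl]
  have h1 := hC n hn
  have h2 := abs_sum_inv_sub hn
  generalize ∑ j ∈ Finset.Ico 1 n, regKern (Real.pi * j / n) = S at h1 ⊢
  generalize ∑ j ∈ Finset.Ico 1 n, 1 / (j : ℝ) = H at h2 ⊢
  have e : n / Real.pi * H + n / Real.pi * H + S
      - (2 * n / Real.pi * (Real.log n + Real.eulerMascheroniConstant)
        + n / Real.pi * (Real.log 2 - 2 * Real.log Real.pi))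
      = 2 * n / Real.pi * (H - (Real.log n + Real.eulerMascheroniConstant - 1 / (2 * n)))
        + (S - (n / Real.pi * (Real.log 2 - 2 * Real.log Real.pi) + 1 / Real.pi)) := by
    field_simp
    ring
  rw [e]
  refine (abs_add_le _ _).trans ?_
  rw [abs_mul, abs_of_pos (show 0 < 2 * n / Real.pi by positivity)]
  calc 2 * n / Real.pi * _ + _ ≤ 2 * n / Real.pi * (1 / (n : ℝ) ^ 2) + C / n := by gcongr
    _ = (C + 2 / Real.pi) / n := by
      field_simp
      ring

end SquareLattice

/-! ### Termwise comparison of the exponentially small part with a Planck weight. -/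

namespace SquareLattice

lemma sub_sin_le_cube {θ : ℝ} (h0 : 0 < θ) : θ - Real.sin θ ≤ θ ^ 3 := by
  have := Real.sin_gt_sub_cube h0
  have : 0 < θ ^ 3 := by positivity
  linarith

/-- The lower bound for log(1 + 1/a) at 1/a = s + √(1 + s²) - 1 simplifies to 2s/(√(1 + s²) + 1). -/
lemma sub_cube_le_arsinh {s : ℝ} (hs : 0 < s) : s - s ^ 3 / 4 ≤ Real.arsinh s := by
  obtain ⟨w, hw⟩ : ∃ w, w = √(1 + s ^ 2) := ⟨_, rfl⟩
  have hw2 : w ^ 2 = 1 + s ^ 2 := hw ▸ Real.sq_sqrt (by positivity)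
  have hw0 : 0 ≤ w := hw ▸ Real.sqrt_nonneg _
  have hw1 : 1 < w := by nlinarith
  have hw3 : w ≤ 1 + s ^ 2 / 2 := by nlinarith [sq_nonneg (s ^ 2)]
  have hy : 0 < s + w - 1 := by linarith
  have h := le_log_one_add_inv (inv_pos.mpr hy)
  rw [inv_inv, show 1 + (s + w - 1) = s + w by ring] at h
  have e : 2 / (2 * (s + w - 1)⁻¹ + 1) = 2 * s / (w + 1) := by
    rw [div_eq_div_iff (by positivity) (by positivity)]
    field_simp
    linear_combination hw2
  rw [Real.arsinh, ← hw]
  refine le_trans ?_ (e ▸ h)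
  rw [le_div_iff₀ (by positivity)]
  by_cases hneg : s - s ^ 3 / 4 ≤ 0
  · nlinarith
  · push Not at hneg
    have h1 : (s - s ^ 3 / 4) * (w + 1) ≤ (s - s ^ 3 / 4) * (2 + s ^ 2 / 2) := by
      apply mul_le_mul_of_nonneg_left _ hneg.le
      linarith
    have h2 : 0 < s ^ 5 := by positivity
    nlinarith

lemma arsinh_le_self {s : ℝ} (hs : 0 ≤ s) : Real.arsinh s ≤ s := by
  have h := Real.self_le_sinh_iff.mpr (Real.arsinh_nonneg_iff.mpr hs)
  rwa [Real.sinh_arsinh] at h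

lemma abs_kern_sub_inv_le {θ : ℝ} (h0 : 0 < θ) (h1 : θ ≤ Real.pi / 2) :
    |kern θ - 1 / θ| ≤ 2 * θ := by
  have hs1 := Real.mul_le_sin h0.le h1
  have hs2 := Real.sin_le h0.le
  have hs3 := sub_sin_le_cube h0
  have hpi := Real.pi_pos
  have hs : 0 < Real.sin θ := Real.sin_pos_of_pos_of_lt_pi h0 (by linarith)
  rw [kern]
  generalize Real.sin θ = s at *
  obtain ⟨w, hw⟩ : ∃ w, w = √(1 + s ^ 2) := ⟨_, rfl⟩
  rw [← hw]
  have hw2 : w ^ 2 = 1 + s ^ 2 := hw ▸ Real.sq_sqrt (by positivity)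
  have hw0 : 0 ≤ w := hw ▸ Real.sqrt_nonneg _
  have hw1 : 1 < w := by nlinarith
  have hw3 : w ≤ 1 + s ^ 2 / 2 := by nlinarith [sq_nonneg (s ^ 2)]
  have hsw : s ≤ s * w := by nlinarith
  have hsw2 : s * w ≤ θ + θ ^ 3 := by
    have h3 : s ^ 3 ≤ θ ^ 3 := by gcongr
    have h4 : s * w ≤ s * (1 + s ^ 2 / 2) := by gcongr
    nlinarith [pow_pos h0 3]
  have habs : |θ - s * w| ≤ θ ^ 3 := abs_le.mpr ⟨by linarith, by linarith⟩
  have e : 1 / (s * w) - 1 / θ = (θ - s * w) / (s * w * θ) := by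
    field_simp
  rw [e, abs_div, abs_of_pos (show 0 < s * w * θ by positivity), div_le_iff₀ (by positivity)]
  have h5 : θ / 2 ≤ s * w := by
    have : 1 / 2 ≤ 2 / Real.pi := by
      rw [div_le_div_iff₀ (by norm_num) hpi]
      linarith [Real.pi_le_four]
    nlinarith
  have h6 : 2 * θ * (θ / 2 * θ) ≤ 2 * θ * (s * w * θ) := by gcongr
  nlinarith

/-- The weight `1 / (θ (e^{2Nθ} - 1))`. -/
noncomputable def planckWeight (N θ : ℝ) : ℝ := 1 / (θ * (Real.exp (2 * N * θ) - 1))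

lemma two_mul_exp_le {y : ℝ} (hy : 1 ≤ y) : Real.exp y ≤ 2 * (Real.exp y - 1) := by
  linarith [Real.add_one_le_exp y]

lemma inv_exp_sub_one_le {y : ℝ} (hy : 1 ≤ y) :
    1 / (Real.exp y - 1) ≤ 2 * Real.exp (-y) := by
  have h1 := two_mul_exp_le hy
  have h2 : 0 < Real.exp y - 1 := by linarith [Real.add_one_le_exp y]
  rw [Real.exp_neg, div_le_iff₀ h2]
  have h3 := Real.exp_pos y
  field_simp
  linarith

lemma inv_exp_sub_inv_exp_le {x y : ℝ} (hx : 1 ≤ x) (hxy : x ≤ y) :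
    |1 / (Real.exp x - 1) - 1 / (Real.exp y - 1)| ≤ 4 * (y - x) * Real.exp (-x) := by
  have hx0 : 0 < Real.exp x - 1 := by linarith [Real.add_one_le_exp x]
  have hy0 : 0 < Real.exp y - 1 := by linarith [Real.add_one_le_exp y]
  have hdiff : Real.exp y - Real.exp x ≤ Real.exp y * (y - x) := by
    have h := Real.add_one_le_exp (x - y)
    have e : Real.exp x = Real.exp y * Real.exp (x - y) := by
      rw [← Real.exp_add]
      congr 1
      ring
    rw [e]
    nlinarith [Real.exp_pos y]
  have hmono : Real.exp x ≤ Real.exp y := Real.exp_le_exp.mpr hxy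
  have e : 1 / (Real.exp x - 1) - 1 / (Real.exp y - 1)
      = (Real.exp y - Real.exp x) / (Real.exp y - 1) * (1 / (Real.exp x - 1)) := by
    field_simp
    ring
  have hnn : 0 ≤ (Real.exp y - Real.exp x) / (Real.exp y - 1) :=
    div_nonneg (by linarith) hy0.le
  rw [e, abs_of_nonneg (by positivity)]
  have h1 : (Real.exp y - Real.exp x) / (Real.exp y - 1) ≤ 2 * (y - x) := by
    rw [div_le_iff₀ hy0]
    have := two_mul_exp_le (hx.trans hxy)
    nlinarith [sub_nonneg.mpr hxy]
  calc _ ≤ 2 * (y - x) * (2 * Real.exp (-x)) := by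
        apply mul_le_mul h1 (inv_exp_sub_one_le hx) (by positivity)
        linarith
    _ = _ := by ring

/-- Replace `kern θ` by 1/θ at cost O(θ), then a = arsinh(sin θ) by θ at cost O(Nθ³) in the
exponent. The bounds θ/π ≤ a and π ≤ Nθ give Na ≥ 1, which keeps e^{2Na} - 1 comparable with
e^{2Na}. -/
lemma abs_kern_div_sub_planckWeight_le {N θ : ℝ} (hN : 0 < N) (h0 : 0 < θ)
    (h1 : θ ≤ Real.pi / 2) (hNθ : Real.pi ≤ N * θ) :
    |kern θ / (Real.exp (2 * N * Real.arsinh (Real.sin θ)) - 1) - planckWeight N θ|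
      ≤ (4 * θ + 16 * N * θ ^ 2) * Real.exp (-(2 * N * θ / Real.pi)) := by
  have hpi := Real.pi_pos
  have hs : 0 < Real.sin θ := Real.sin_pos_of_pos_of_lt_pi h0 (by linarith)
  have hs1 := Real.mul_le_sin h0.le h1
  have hs2 := Real.sin_le h0.le
  have hs3 := sub_sin_le_cube h0
  have ha1 := sub_cube_le_arsinh hs
  have ha2 := arsinh_le_self hs.le
  have hsle := Real.sin_le_one θ
  have hk := abs_kern_sub_inv_le h0 h1
  generalize Real.arsinh (Real.sin θ) = a at *
  generalize Real.sin θ = s at *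
  have hcube : s ^ 3 ≤ θ ^ 3 := by gcongr
  have hdiff : θ - a ≤ 2 * θ ^ 3 := by nlinarith [pow_pos h0 3]
  have haθ : θ / Real.pi ≤ a := by
    have h2 : s ^ 3 ≤ s := by
      have : s ^ 2 ≤ 1 := by nlinarith
      nlinarith
    have h3 : 2 * (θ / Real.pi) ≤ s := by
      calc 2 * (θ / Real.pi) = 2 / Real.pi * θ := by ring
        _ ≤ s := hs1
    linarith [div_pos h0 hpi]
  have hNa : 1 ≤ N * a := by
    have : N * (θ / Real.pi) ≤ N * a := by gcongr
    refine le_trans ?_ this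
    rw [← mul_div_assoc, le_div_iff₀ hpi]
    linarith
  have hE : Real.exp (-(2 * N * a)) ≤ Real.exp (-(2 * N * θ / Real.pi)) := by
    apply Real.exp_le_exp.mpr
    have : 2 * N * (θ / Real.pi) ≤ 2 * N * a := by gcongr
    have e : 2 * N * θ / Real.pi = 2 * N * (θ / Real.pi) := by ring
    linarith
  have hle : 2 * N * a ≤ 2 * N * θ := by
    have : a ≤ θ := by linarith
    gcongr
  have hd := inv_exp_sub_inv_exp_le (show 1 ≤ 2 * N * a by linarith) hle
  have hi := inv_exp_sub_one_le (show 1 ≤ 2 * N * a by linarith)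
  have hpos : 0 < Real.exp (2 * N * a) - 1 := by
    linarith [Real.add_one_le_exp (2 * N * a)]
  have e : kern θ / (Real.exp (2 * N * a) - 1) - planckWeight N θ
      = (kern θ - 1 / θ) * (1 / (Real.exp (2 * N * a) - 1))
        + 1 / θ * (1 / (Real.exp (2 * N * a) - 1) - 1 / (Real.exp (2 * N * θ) - 1)) := by
    rw [planckWeight, one_div_mul_eq_div, ← div_div]
    ring
  rw [e]
  refine (abs_add_le _ _).trans ?_
  rw [abs_mul, abs_mul, abs_of_pos (one_div_pos.mpr hpos), abs_of_pos (one_div_pos.mpr h0)]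
  generalize Real.exp (-(2 * N * a)) = Ea at *
  generalize Real.exp (-(2 * N * θ / Real.pi)) = E at *
  have hEa : 0 ≤ Ea := by
    have := (one_div_pos.mpr hpos)
    linarith
  have t1 : |kern θ - 1 / θ| * (1 / (Real.exp (2 * N * a) - 1)) ≤ 2 * θ * (2 * E) := by
    apply mul_le_mul hk (hi.trans (by linarith)) (one_div_pos.mpr hpos).le (by positivity)
  have t2 : 1 / θ * |1 / (Real.exp (2 * N * a) - 1) - 1 / (Real.exp (2 * N * θ) - 1)|
      ≤ 1 / θ * (4 * (2 * N * (2 * θ ^ 3)) * E) := by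
    apply mul_le_mul_of_nonneg_left _ (one_div_pos.mpr h0).le
    refine hd.trans ?_
    have hNd : 2 * N * θ - 2 * N * a ≤ 2 * N * (2 * θ ^ 3) := by
      rw [← mul_sub]
      gcongr
    apply mul_le_mul (by linarith) hE hEa (by positivity)
  have e2 : 1 / θ * (4 * (2 * N * (2 * θ ^ 3)) * E) = 16 * N * θ ^ 2 * E := by
    field_simp
    ring
  rw [e2] at t2
  linarith

lemma planckWeight_pi_sub_le {N θ : ℝ} (hN : 1 ≤ N) (h1 : θ ≤ Real.pi / 2) :
    planckWeight N (Real.pi - θ) ≤ 2 / N * Real.exp (-N) := by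
  have hpi := Real.pi_gt_three
  have hx : 3 / 2 ≤ Real.pi - θ := by linarith
  have hNx : 2 * N ≤ 2 * N * (Real.pi - θ) := by nlinarith
  have hi := inv_exp_sub_one_le (show 1 ≤ 2 * N * (Real.pi - θ) by linarith)
  have hpos : 0 < Real.exp (2 * N * (Real.pi - θ)) - 1 := by
    linarith [Real.add_one_le_exp (2 * N * (Real.pi - θ))]
  have hN0 : 0 < N := by linarith
  have h2 : Real.exp (-N) ≤ 1 / N := by
    rw [Real.exp_neg, one_div]
    exact inv_anti₀ hN0 (by linarith [Real.add_one_le_exp N])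
  have h3 : Real.exp (-(2 * N * (Real.pi - θ))) ≤ Real.exp (-N) * Real.exp (-N) := by
    rw [← Real.exp_add]
    exact Real.exp_le_exp.mpr (by linarith)
  rw [planckWeight, one_div, mul_inv]
  calc (Real.pi - θ)⁻¹ * (Real.exp (2 * N * (Real.pi - θ)) - 1)⁻¹
      ≤ 1 * (2 * Real.exp (-(2 * N * (Real.pi - θ)))) := by
        apply mul_le_mul (inv_le_one_of_one_le₀ (by linarith)) (by rwa [← one_div])
          (by positivity) (by norm_num)
    _ ≤ 1 * (2 * (Real.exp (-N) * Real.exp (-N))) := by gcongr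
    _ ≤ 1 * (2 * (1 / N * Real.exp (-N))) := by gcongr
    _ = _ := by ring

/-- The summable weight `j² e^{-2j}`. -/
noncomputable def tailWeight (j : ℕ) : ℝ := (j : ℝ) ^ 2 * Real.exp (-(2 * j))

lemma tailWeight_nonneg (j : ℕ) : 0 ≤ tailWeight j := by
  rw [tailWeight]
  positivity

lemma summable_tailWeight : Summable tailWeight := by
  refine (Real.summable_pow_mul_exp_neg_nat_mul 2 (show (0 : ℝ) < 2 by norm_num)).congr fun j => ?_
  rw [tailWeight]
  ring_nf

lemma abs_kern_div_sub_le_of_le_half {n j : ℕ} (hj : 0 < j) (hjn : 2 * j ≤ n) :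
    |kern (Real.pi * j / n)
        / (Real.exp (2 * n * Real.arsinh (Real.sin (Real.pi * j / n))) - 1)
      - (planckWeight n (Real.pi * j / n) + planckWeight n (Real.pi - Real.pi * j / n))|
      ≤ 220 / n * tailWeight j := by
  have hpi := Real.pi_pos
  have hj1 : (1 : ℝ) ≤ j := by exact_mod_cast hj
  have hjn' : 2 * (j : ℝ) ≤ n := by exact_mod_cast hjn
  have hn : (0 : ℝ) < n := by linarith
  have h0 : 0 < Real.pi * j / n := by positivity
  have h1 : Real.pi * j / n ≤ Real.pi / 2 := by
    rw [div_le_div_iff₀ hn (by norm_num)]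
    nlinarith
  have hN : (n : ℝ) * (Real.pi * j / n) = Real.pi * j := by field_simp
  have hA := abs_kern_div_sub_planckWeight_le hn h0 h1 (by rw [hN]; nlinarith)
  have hB := planckWeight_pi_sub_le (show (1 : ℝ) ≤ n by linarith) h1
  have hB0 : 0 ≤ planckWeight n (Real.pi - Real.pi * j / n) := by
    have hx : 0 < Real.pi - Real.pi * j / n := by linarith
    have : 0 < Real.exp (2 * n * (Real.pi - Real.pi * j / n)) - 1 := by
      have : 0 < 2 * n * (Real.pi - Real.pi * j / n) := by positivity
      linarith [Real.add_one_lt_exp this.ne']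
    rw [planckWeight]
    positivity
  have hE : Real.exp (-(n : ℝ)) ≤ Real.exp (-(2 * j)) := Real.exp_le_exp.mpr (by linarith)
  have e1 : 2 * (n : ℝ) * (Real.pi * j / n) / Real.pi = 2 * j := by field_simp
  have e2 : 4 * (Real.pi * j / n) + 16 * n * (Real.pi * j / n) ^ 2
      = (4 * Real.pi * j + 16 * Real.pi ^ 2 * j ^ 2) / n := by field_simp
  rw [e1, e2] at hA
  rw [tailWeight, ← sub_sub]
  have hEp := Real.exp_pos (-(2 * (j : ℝ)))
  generalize Real.exp (-(2 * (j : ℝ))) = E at *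
  refine (abs_sub _ _).trans ?_
  rw [abs_of_nonneg hB0]
  have hB' : planckWeight n (Real.pi - Real.pi * j / n) ≤ 2 / n * E :=
    hB.trans (by gcongr)
  have hpi2 : Real.pi ≤ 3.15 := Real.pi_lt_d2.le
  -- For j ≥ 1 and π ≤ 3.15 the left side is below 174 j², so 220 is a generous constant.
  have hc : 4 * Real.pi * j + 16 * Real.pi ^ 2 * j ^ 2 + 2 ≤ 220 * (j : ℝ) ^ 2 := by
    have hj2 : (j : ℝ) ≤ j ^ 2 := by nlinarith
    have hp2 : Real.pi ^ 2 ≤ 3.15 ^ 2 := by gcongr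
    have t1 : Real.pi * j ≤ 3.15 * (j : ℝ) ^ 2 := by gcongr
    have t2 : Real.pi ^ 2 * (j : ℝ) ^ 2 ≤ 3.15 ^ 2 * (j : ℝ) ^ 2 := by gcongr
    nlinarith
  calc _ ≤ (4 * Real.pi * j + 16 * Real.pi ^ 2 * j ^ 2) / n * E + 2 / n * E := add_le_add hA hB'
    _ = (4 * Real.pi * j + 16 * Real.pi ^ 2 * j ^ 2 + 2) / n * E := by ring
    _ ≤ 220 * (j : ℝ) ^ 2 / n * E := by gcongr
    _ = _ := by ring

lemma abs_kern_div_sub_le {n j : ℕ} (hj : 0 < j) (hjn : j < n) :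
    |kern (Real.pi * j / n)
        / (Real.exp (2 * n * Real.arsinh (Real.sin (Real.pi * j / n))) - 1)
      - (planckWeight n (Real.pi * j / n) + planckWeight n (Real.pi * (n - j : ℕ) / n))|
      ≤ 220 / n * (tailWeight j + tailWeight (n - j)) := by
  have hn : (n : ℝ) ≠ 0 := by
    have : n ≠ 0 := by omega
    exact_mod_cast this
  have e : Real.pi * (n - j : ℕ) / n = Real.pi - Real.pi * j / n := by
    rw [Nat.cast_sub hjn.le]
    field_simp
  have hc : (0 : ℝ) ≤ 220 / n := by positivity
  rcases le_or_gt (2 * j) n with h | h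
  · rw [e]
    refine (abs_kern_div_sub_le_of_le_half hj h).trans ?_
    exact mul_le_mul_of_nonneg_left (by linarith [tailWeight_nonneg (n - j)]) hc
  · have h2 := abs_kern_div_sub_le_of_le_half (n := n) (j := n - j) (by omega) (by omega)
    rw [e, kern_pi_sub, Real.sin_pi_sub, sub_sub_cancel] at h2
    rw [e, add_comm (planckWeight _ _)]
    refine h2.trans ?_
    exact mul_le_mul_of_nonneg_left (by linarith [tailWeight_nonneg j]) hc

end SquareLattice

/-! ### Summing the comparison and assembling the constant. -/

namespace SquareLattice

open Finset

/-- The terms `1 / (j (e^{2πj} - 1))` of the Lambert series. -/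
noncomputable def lambertTerm (j : ℕ) : ℝ := 1 / ((j : ℝ) * (Real.exp (2 * Real.pi * j) - 1))

/-- The value `∑_{j ≥ 1} 1 / (j (e^{2πj} - 1))`. -/
noncomputable def lambertValue : ℝ :=
  Real.log 2 + 3 / 4 * Real.log Real.pi - Real.pi / 12 - Real.log (Real.Gamma (1 / 4))

lemma hasSum_lambertTerm_succ : HasSum (fun j => lambertTerm (j + 1)) lambertValue := by
  refine GaussLattice.hasSum_lambert.congr_fun fun j => ?_
  rw [lambertTerm]
  push_cast
  rfl

lemma planckWeight_eq {n : ℕ} (hn : 0 < n) (j : ℕ) :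
    planckWeight n (Real.pi * j / n) = n / Real.pi * lambertTerm j := by
  have hn' : (n : ℝ) ≠ 0 := by exact_mod_cast hn.ne'
  rw [planckWeight, lambertTerm, show 2 * (n : ℝ) * (Real.pi * j / n) = 2 * Real.pi * j by
    field_simp]
  simp only [mul_inv, div_eq_mul_inv, inv_inv]
  ring

lemma lambertTerm_nonneg (j : ℕ) : 0 ≤ lambertTerm j := by
  have : 0 ≤ Real.exp (2 * Real.pi * j) - 1 := by
    have : 0 ≤ 2 * Real.pi * j := by positivity
    linarith [Real.add_one_le_exp (2 * Real.pi * j)]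
  rw [lambertTerm]
  positivity

lemma sq_mul_lambertTerm_le (j : ℕ) : (j : ℝ) ^ 2 * lambertTerm j ≤ 2 * tailWeight j := by
  rcases Nat.eq_zero_or_pos j with rfl | hj
  · simp [tailWeight]
  have hj1 : (1 : ℝ) ≤ j := by exact_mod_cast hj
  have hpi := Real.pi_gt_three
  have hle : 2 * (j : ℝ) ≤ 2 * Real.pi * j := by nlinarith
  have hi := inv_exp_sub_one_le (show 1 ≤ 2 * Real.pi * (j : ℝ) by linarith)
  have hE : Real.exp (-(2 * Real.pi * (j : ℝ))) ≤ Real.exp (-(2 * j)) :=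
    Real.exp_le_exp.mpr (by linarith)
  have hpos : 0 < Real.exp (2 * Real.pi * j) - 1 := by
    linarith [Real.add_one_le_exp (2 * Real.pi * (j : ℝ))]
  have h1 : lambertTerm j ≤ 2 * Real.exp (-(2 * j)) := by
    rw [lambertTerm, one_div, mul_inv]
    calc (j : ℝ)⁻¹ * (Real.exp (2 * Real.pi * j) - 1)⁻¹
        ≤ 1 * (2 * Real.exp (-(2 * Real.pi * (j : ℝ)))) := by
          apply mul_le_mul (inv_le_one_of_one_le₀ hj1) (by rwa [← one_div]) (by positivity)
            (by norm_num)
      _ ≤ _ := by linarith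
  rw [tailWeight]
  nlinarith [sq_nonneg (j : ℝ)]

/-- Beyond n each term gains a factor 1/n² from j² ≥ n², paid for by the summable weight j² e^{-2j}.
-/
lemma abs_sum_lambertTerm_sub {n : ℕ} (hn : 0 < n) :
    |∑ j ∈ Ico 1 n, lambertTerm j - lambertValue| ≤ 2 * (∑' j, tailWeight j) / (n : ℝ) ^ 2 := by
  have hn' : (0 : ℝ) < n := by exact_mod_cast hn
  have hsum : ∑ j ∈ Ico 1 n, lambertTerm j = ∑ i ∈ range (n - 1), lambertTerm (i + 1) := by
    rw [sum_Ico_eq_sum_range]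
    exact sum_congr rfl fun i _ => by rw [add_comm]
  have hsplit := hasSum_lambertTerm_succ.summable.sum_add_tsum_nat_add (n - 1)
  rw [hasSum_lambertTerm_succ.tsum_eq] at hsplit
  have htail : Summable fun i => tailWeight (i + n) :=
    (summable_nat_add_iff n).mpr summable_tailWeight
  have hshift : ∀ i, lambertTerm (i + (n - 1) + 1) = lambertTerm (i + n) := fun i => by
    congr 1
    omega
  simp only [hshift] at hsplit
  have hbound : ∀ i, lambertTerm (i + n) ≤ 2 / (n : ℝ) ^ 2 * tailWeight (i + n) := by
    intro i
    have h1 := sq_mul_lambertTerm_le (i + n)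
    have h2 := lambertTerm_nonneg (i + n)
    have h3 : (n : ℝ) ^ 2 ≤ ((i + n : ℕ) : ℝ) ^ 2 := by
      push_cast
      have : (0 : ℝ) ≤ i := Nat.cast_nonneg i
      gcongr
      linarith
    rw [div_mul_eq_mul_div, le_div_iff₀ (by positivity)]
    nlinarith
  have hsl : Summable fun i => lambertTerm (i + n) :=
    Summable.of_nonneg_of_le (fun i => lambertTerm_nonneg _) hbound (htail.mul_left _)
  have h4 : ∑' i, lambertTerm (i + n) ≤ 2 / (n : ℝ) ^ 2 * ∑' i, tailWeight (i + n) := by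
    rw [← tsum_mul_left]
    exact hsl.tsum_le_tsum hbound (htail.mul_left _)
  have h5 : ∑' i, tailWeight (i + n) ≤ ∑' j, tailWeight j := by
    have := summable_tailWeight.sum_add_tsum_nat_add n
    have h6 : 0 ≤ ∑ i ∈ range n, tailWeight i := sum_nonneg fun i _ => tailWeight_nonneg i
    linarith
  have h7 : 0 ≤ ∑' i, lambertTerm (i + n) := tsum_nonneg fun i => lambertTerm_nonneg _
  rw [hsum, ← hsplit, sub_add_cancel_left, abs_neg, abs_of_nonneg h7]
  calc _ ≤ 2 / (n : ℝ) ^ 2 * ∑' i, tailWeight (i + n) := h4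
    _ ≤ 2 / (n : ℝ) ^ 2 * ∑' j, tailWeight j := by gcongr
    _ = _ := by ring

lemma sum_Ico_sub (f : ℕ → ℝ) (n : ℕ) : ∑ j ∈ Ico 1 n, f (n - j) = ∑ j ∈ Ico 1 n, f j := by
  have := sum_Ico_reflect f 1 (show n ≤ n + 1 by omega)
  simpa [show n + 1 - n = 1 by omega] using this

lemma exists_abs_sum_kern_div_sub :
    ∃ C, ∀ n : ℕ, 0 < n → |∑ j ∈ Ico 1 n, kern (Real.pi * j / n)
        / (Real.exp (2 * n * Real.arsinh (Real.sin (Real.pi * j / n))) - 1)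
      - 2 * n / Real.pi * lambertValue| ≤ C / n := by
  obtain ⟨K, hK⟩ : ∃ K, K = ∑' j, tailWeight j := ⟨_, rfl⟩
  refine ⟨440 * K + 4 / Real.pi * K, fun n hn => ?_⟩
  have hn' : (0 : ℝ) < n := by exact_mod_cast hn
  have hpi := Real.pi_pos
  have h1 : |∑ j ∈ Ico 1 n, kern (Real.pi * j / n)
        / (Real.exp (2 * n * Real.arsinh (Real.sin (Real.pi * j / n))) - 1)
      - 2 * n / Real.pi * ∑ j ∈ Ico 1 n, lambertTerm j| ≤ 440 * K / n := by
    have e : 2 * n / Real.pi * ∑ j ∈ Ico 1 n, lambertTerm j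
        = ∑ j ∈ Ico 1 n, (planckWeight n (Real.pi * j / n)
          + planckWeight n (Real.pi * (n - j : ℕ) / n)) := by
      simp only [planckWeight_eq hn]
      rw [sum_add_distrib, ← mul_sum, ← mul_sum, sum_Ico_sub lambertTerm]
      ring
    rw [e, ← sum_sub_distrib]
    refine (abs_sum_le_sum_abs _ _).trans ?_
    refine (sum_le_sum fun j hj => abs_kern_div_sub_le (mem_Ico.mp hj).1 (mem_Ico.mp hj).2).trans ?_
    rw [← mul_sum, sum_add_distrib, sum_Ico_sub tailWeight]
    have h2 : ∑ j ∈ Ico 1 n, tailWeight j ≤ K :=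
      hK ▸ summable_tailWeight.sum_le_tsum _ fun j _ => tailWeight_nonneg j
    calc 220 / (n : ℝ) * _ ≤ 220 / n * (K + K) := by gcongr
      _ = _ := by ring
  have h2 := abs_sum_lambertTerm_sub hn
  rw [← hK] at h2
  generalize ∑ j ∈ Ico 1 n, lambertTerm j = L at h1 h2
  generalize ∑ j ∈ Ico 1 n, kern (Real.pi * j / n)
        / (Real.exp (2 * n * Real.arsinh (Real.sin (Real.pi * j / n))) - 1) = S at h1 ⊢
  have e : S - 2 * n / Real.pi * lambertValue
      = S - 2 * n / Real.pi * L + 2 * n / Real.pi * (L - lambertValue) := by ring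
  rw [e]
  refine (abs_add_le _ _).trans ?_
  rw [abs_mul, abs_of_pos (show 0 < 2 * n / Real.pi by positivity)]
  calc _ ≤ 440 * K / n + 2 * n / Real.pi * (2 * K / (n : ℝ) ^ 2) := by gcongr
    _ = _ := by
      field_simp
      ring

lemma log_constant : Real.log (32 * Real.pi / Real.Gamma (1 / 4) ^ 4)
    = 5 * Real.log 2 + Real.log Real.pi - 4 * Real.log (Real.Gamma (1 / 4)) := by
  have hG : 0 < Real.Gamma (1 / 4) := Real.Gamma_pos_of_pos (by norm_num)
  have hpi := Real.pi_pos
  rw [Real.log_div (by positivity) (by positivity), Real.log_mul (by norm_num) hpi.ne',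
    Real.log_pow, show (32 : ℝ) = 2 ^ 5 by norm_num, Real.log_pow]
  push_cast
  ring

lemma exists_abs_squareSum_sub :
    ∃ C, ∀ n : ℕ, 0 < n → |squareSum n - (2 / Real.pi * (n : ℝ) ^ 2 * Real.log n +
          1 / Real.pi * (2 * Real.eulerMascheroniConstant +
            Real.log (32 * Real.pi / Real.Gamma (1 / 4) ^ 4)) * (n : ℝ) ^ 2)| ≤ C := by
  obtain ⟨C₁, h₁⟩ := exists_abs_sum_kern_sub
  obtain ⟨C₂, h₂⟩ := exists_abs_sum_kern_div_sub
  refine ⟨1 / 3 + C₁ + 2 * C₂, fun n hn => ?_⟩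
  have hn' : (0 : ℝ) < n := by exact_mod_cast hn
  have hpi := Real.pi_pos
  have hA := h₁ n hn
  have hB := h₂ n hn
  rw [squareSum_eq hn, log_constant]
  generalize ∑ j ∈ Ico 1 n, kern (Real.pi * j / n)
        / (Real.exp (2 * n * Real.arsinh (Real.sin (Real.pi * j / n))) - 1) = B at hB ⊢
  generalize ∑ j ∈ Ico 1 n, kern (Real.pi * j / n) = A at hA ⊢
  -- The -π/12 in `lambertValue`, multiplied by 4n²/π, cancels n²/3; only -1/3 and the two error
  -- terms survive.
  have e : ((n : ℝ) ^ 2 - 1) / 3 + n * A + 2 * n * B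
      - (2 / Real.pi * (n : ℝ) ^ 2 * Real.log n +
          1 / Real.pi * (2 * Real.eulerMascheroniConstant +
            (5 * Real.log 2 + Real.log Real.pi - 4 * Real.log (Real.Gamma (1 / 4)))) * (n : ℝ) ^ 2)
      = -(1 / 3) + n * (A - (2 * n / Real.pi * (Real.log n + Real.eulerMascheroniConstant)
          + n / Real.pi * (Real.log 2 - 2 * Real.log Real.pi)))
        + 2 * n * (B - 2 * n / Real.pi * lambertValue) := by
    rw [lambertValue]
    field_simp
    ring
  rw [e]
  refine (abs_add_le _ _).trans ?_
  refine (add_le_add_left (abs_add_le _ _) _).trans ?_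
  rw [abs_mul, abs_mul, abs_neg, abs_of_pos hn', abs_of_pos (show 0 < 2 * (n : ℝ) by positivity),
    abs_of_pos (show (0 : ℝ) < 1 / 3 by norm_num)]
  calc _ ≤ 1 / 3 + n * (C₁ / n) + 2 * n * (C₂ / n) := by gcongr
    _ = _ := by field_simp

end SquareLattice

theorem mainTheorem6 :
    (∀ n : ℕ, 0 < n →
      latticeSum squarePhi (Pi.basisFun ℝ (Fin 2)) n = ((squareSum n : ℝ) : ℂ)) ∧
    (fun n : ℕ => squareSum n -
        (2 / Real.pi * (n : ℝ) ^ 2 * Real.log n +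
          1 / Real.pi * (2 * Real.eulerMascheroniConstant +
            Real.log (32 * Real.pi / Real.Gamma (1 / 4) ^ 4)) * (n : ℝ) ^ 2))
      =O[atTop] (fun n : ℕ => Real.log (n : ℝ)) := by
  refine ⟨fun n _ => SquareLattice.latticeSum_squarePhi n, ?_⟩
  obtain ⟨C, hC⟩ := SquareLattice.exists_abs_squareSum_sub
  -- The error is bounded, and log n ≥ 1 eventually.
  refine IsBigO.of_bound C ?_
  filter_upwards [eventually_gt_atTop 0,
    (Real.tendsto_log_atTop.comp tendsto_natCast_atTop_atTop).eventually_ge_atTop 1] with n hn hlog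
  have h := hC n hn
  have hlog' : 1 ≤ ‖Real.log (n : ℝ)‖ := hlog.trans (le_abs_self _)
  rw [Real.norm_eq_abs]
  have hC0 : 0 ≤ C := (abs_nonneg _).trans h
  nlinarith
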